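/- Let $(X,d,\mu)$ be a complete metric space with a Borel regular measure $\mu$ that is doubling: for some $c_D\ge 1$, $0<\mu(B_{2r}(x))\le c_D\,\mu(B_r(x))<\infty$ for all $x\in X$, $r>0$, where $B_r(x)=\{y: d(x,y)<r\}$. Assume that $X$ supports a $1$-Poincaré inequality: there are $c_P>0$ and $\lambda\ge 1$ such that for every Lipschitz function $u:X\to\mathbb R$ and every ball $B_r(x)$, $$\int_{B_r(x)}|u-u_{B_r(x)}|\,d\mu\le c_P\,r\int_{B_{\lambda r}(x)}\mathrm{lip}(u)\,d\mu,\qquad \mathrm{lip}(u)(y)=\liminf_{\varrho\to0^+}\sup_{z\in B_\varrho(y)}\frac{|u(y)-u(z)|}{d(y,z)},$$ where $u_B$ denotes the mean value of $u$ over $B$ (and the term $z=y$ counts as $0$). For $u\in L^1(X)$ put $$\|Du\|(X)=\inf\Big\{\liminf_{j\to\infty}\int_X g_{u_j}\,d\mu:\ u_j\in \mathrm{Lip}_{\mathrm{loc}}(X),\ u_j\to u\text{ in }L^1_{\mathrm{loc}}(X)\Big\},$$ where $g_{u_j}$ is the minimal $1$-weak upper gradient of $u_j$ (with $\int_X g_{u_j}\,d\mu=\infty$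 if $u_j$ has no integrable $1$-weak upper gradient), and say that $u\in \mathrm{BV}(X)$ if $\|Du\|(X)<\infty$. For $\varepsilon>0$ let $\Delta^\varepsilon=\{(x,y)\in X\times X: d(x,y)<\varepsilon\}$ and $$E_\varepsilon(u)=\frac1\varepsilon\int_{\Delta^\varepsilon}\frac{|u(x)-u(y)|}{\sqrt{\mu(B_\varepsilon(x))}\sqrt{\mu(B_\varepsilon(y))}}\,d(\mu\otimes\mu)(x,y).$$ **Theorem.** Let $u\in L^1(X)$. Then $u\in \mathrm{BV}(X)$ if and only if $\liminf_{\varepsilon\to0^+}E_\varepsilon(u)<\infty$. Moreover, there is a constant $C>0$, depending only on $c_D$, $c_P$ and $\lambda$, such that $E_\varepsilon(u)\le C\,\|Du\|(X)$ for every $u\in \mathrm{BV}(X)$ and every $\varepsilon>0$; in particular $\limsup_{\varepsilon\to0^+}E_\varepsilon(u)<\infty$ for every $u\in\mathrm{BV}(X)$. -/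

import Mathlib

open MeasureTheory Filter Set Metric Topology
open scoped ENNReal NNReal

noncomputable section

namespace NearDiagonal

/-- The Borel measure `μ` is doubling with constant `cD`. -/
structure IsDoublingWith {X : Type*} [MetricSpace X] [MeasurableSpace X]
    (cD : ℝ) (μ : Measure X) : Prop where
  one_le : 1 ≤ cD
  ball_pos : ∀ (x : X) (r : ℝ), 0 < r → 0 < μ (ball x (2 * r))
  ball_le : ∀ (x : X) (r : ℝ), 0 < r → μ (ball x (2 * r)) ≤ ENNReal.ofReal cD * μ (ball x r)
  ball_lt_top : ∀ (x : X) (r : ℝ), 0 < r → μ (ball x r) < ∞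

/-- The local Lipschitz constant
`lip u (y) = liminf_{ρ → 0+} sup_{z ∈ B_ρ(y)} |u y - u z| / d(y, z)`;
the term `z = y` contributes `0`. -/
def lip {X : Type*} [MetricSpace X] (u : X → ℝ) (y : X) : ℝ≥0∞ :=
  liminf (fun ρ : ℝ => ⨆ z ∈ ball y ρ, ENNReal.ofReal (|u y - u z| / dist y z)) (𝓝[>] 0)

/-- `(X, d, μ)` supports a `1`-Poincaré inequality with constant `cP` and dilation `lam`:
for every Lipschitz function `u` and every ball `B = B_r(x)`,
`∫_B |u - u_B| dμ ≤ cP r ∫_{lam B} lip u dμ`, where `u_B` is the mean value of `u` over `B`. -/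
structure SupportsPoincareWith {X : Type*} [MetricSpace X] [MeasurableSpace X]
    (cP lam : ℝ) (μ : Measure X) : Prop where
  const_pos : 0 < cP
  one_le_dilation : 1 ≤ lam
  poincare : ∀ u : X → ℝ, (∃ K : ℝ≥0, LipschitzWith K u) → ∀ (x : X) (r : ℝ), 0 < r →
    ∫⁻ y in ball x r, ENNReal.ofReal |u y - ⨍ z in ball x r, u z ∂μ| ∂μ
      ≤ ENNReal.ofReal (cP * r) * ∫⁻ y in ball x (lam * r), lip u y ∂μ

/-- A nonconstant compact rectifiable curve in `X`, parametrized by arc length on `[0, length]`.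
(The values of `toFun` outside `[0, length]` are irrelevant.) -/
structure RectifiableCurve (X : Type*) [MetricSpace X] where
  length : ℝ
  length_pos : 0 < length
  toFun : ℝ → X
  unitSpeed : HasUnitSpeedOn toFun (Icc 0 length)

/-- The line integral `∫_γ g ds`. -/
def RectifiableCurve.integral {X : Type*} [MetricSpace X] (γ : RectifiableCurve X)
    (g : X → ℝ≥0∞) : ℝ≥0∞ :=
  ∫⁻ t in Icc 0 γ.length, g (γ.toFun t)

/-- The `1`-modulus of a family of curves: the infimum of `∫ ρ dμ` over all Borel functions
`ρ : X → [0, ∞]` with `∫_γ ρ ds ≥ 1` for every curve `γ` of the family. -/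
def modulusOne {X : Type*} [MetricSpace X] [MeasurableSpace X]
    (μ : Measure X) (Γ : Set (RectifiableCurve X)) : ℝ≥0∞ :=
  ⨅ (ρ : X → ℝ≥0∞) (_ : Measurable ρ) (_ : ∀ γ ∈ Γ, 1 ≤ γ.integral ρ), ∫⁻ x, ρ x ∂μ

/-- `g` is a `1`-weak upper gradient of `u`: `g` is Borel, with values in `[0, ∞]`, and
`|u(γ(0)) - u(γ(ℓ))| ≤ ∫_γ g ds` for all nonconstant compact rectifiable curves `γ` outside a
family of `1`-modulus zero. -/
def IsWeakUpperGradient {X : Type*} [MetricSpace X] [MeasurableSpace X]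
    (μ : Measure X) (u : X → ℝ) (g : X → ℝ≥0∞) : Prop :=
  Measurable g ∧
    modulusOne μ {γ | ¬ ENNReal.ofReal |u (γ.toFun 0) - u (γ.toFun γ.length)| ≤ γ.integral g} = 0

/-- `∫_X g_u dμ`, where `g_u` is the minimal `1`-weak upper gradient of `u`; the value is `∞` if
`u` has no `μ`-integrable `1`-weak upper gradient. As `g_u ≤ g` almost everywhere for each
integrable `1`-weak upper gradient `g` of `u`, this is the least value of `∫_X g dμ`
(see `gradientEnergy_eq_of_minimal`). -/
def gradientEnergy {X : Type*} [MetricSpace X] [MeasurableSpace X]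
    (μ : Measure X) (u : X → ℝ) : ℝ≥0∞ :=
  ⨅ (g : X → ℝ≥0∞) (_ : IsWeakUpperGradient μ u g), ∫⁻ x, g x ∂μ

theorem gradientEnergy_eq_of_minimal {X : Type*} [MetricSpace X] [MeasurableSpace X]
    (μ : Measure X) (u : X → ℝ) (g : X → ℝ≥0∞) (hg : IsWeakUpperGradient μ u g)
    (hmin : ∀ g' : X → ℝ≥0∞, IsWeakUpperGradient μ u g' → ∫⁻ x, g' x ∂μ < ∞ → g ≤ᵐ[μ] g') :
    gradientEnergy μ u = ∫⁻ x, g x ∂μ := by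
  refine le_antisymm (iInf₂_le g hg) (le_iInf₂ fun g' hg' => ?_)
  rcases lt_or_ge (∫⁻ x, g' x ∂μ) ∞ with h | h
  · exact lintegral_mono_ae (hmin g' hg' h)
  · exact le_top.trans h

/-- `v j → u` in `L¹_loc(X)`: convergence in `L¹` on every ball. (In a complete space with a
doubling measure closed balls are compact, so this is the same as `L¹`-convergence on compact
sets.) -/
def TendstoL1Loc {X : Type*} [MetricSpace X] [MeasurableSpace X]
    (μ : Measure X) (v : ℕ → X → ℝ) (u : X → ℝ) : Prop :=
  ∀ (x : X) (r : ℝ), 0 < r →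
    Tendsto (fun j => ∫⁻ y in ball x r, ENNReal.ofReal |v j y - u y| ∂μ) atTop (𝓝 0)

/-- The total variation `‖Du‖(X)`: the infimum of `liminf_j ∫_X g_{v_j} dμ` over all sequences of
locally Lipschitz functions `v_j → u` in `L¹_loc(X)`. -/
def totalVariation {X : Type*} [MetricSpace X] [MeasurableSpace X]
    (μ : Measure X) (u : X → ℝ) : ℝ≥0∞ :=
  ⨅ (v : ℕ → X → ℝ) (_ : ∀ j, LocallyLipschitz (v j)) (_ : TendstoL1Loc μ v u),
    liminf (fun j => gradientEnergy μ (v j)) atTop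

/-- `u ∈ BV(X)`. -/
def IsBV {X : Type*} [MetricSpace X] [MeasurableSpace X]
    (μ : Measure X) (u : X → ℝ) : Prop :=
  Integrable u μ ∧ totalVariation μ u < ∞

/-- The near-diagonal energy
`(1/ε) ∫_{Δ^ε} |u x - u y| / (√μ(B_ε(x)) √μ(B_ε(y))) d(μ ⊗ μ)(x, y)`,
`Δ^ε = {(x, y) : d(x, y) < ε}`. -/
def nearDiagonalEnergy {X : Type*} [MetricSpace X] [MeasurableSpace X]
    (μ : Measure X) (u : X → ℝ) (ε : ℝ) : ℝ≥0∞ :=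
  ENNReal.ofReal (1 / ε) *
    ∫⁻ p in {p : X × X | dist p.1 p.2 < ε},
      ENNReal.ofReal (|u p.1 - u p.2| / (√(μ.real (ball p.1 ε)) * √(μ.real (ball p.2 ε))))
      ∂(μ.prod μ)

end NearDiagonal

end

/-! ### Doubling measures: comparable balls, properness, Tonelli near the diagonal -/

namespace NearDiagonal

variable {X : Type*} [MetricSpace X] [MeasurableSpace X] {μ : Measure X} {cD : ℝ}

/-! By doubling, the symmetric weight in $E_\varepsilon$ may be replaced by
$1/\mu(B_\varepsilon(x))$ at the cost of a factor (`ballEnergy`).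

Finite energy gives BV: average $u$ against tents of radius $\delta=\varepsilon/2$. The averages are
locally Lipschitz. The mean of $|u(z)-u(\cdot)|$ over $B_\varepsilon(z)$, divided by $\delta$, is up
to a constant an upper gradient, and its integral is the energy at scale $\varepsilon$. The $L^1$
distance to $u$ is at most a multiple of $\varepsilon$ times that energy. Scales along which the
energy stays bounded thus give competitors for $\|Du\|(X)$ (`totalVariation_lt_top`).

The bound by $\|Du\|(X)$: for fixed $\varepsilon$ the energy is lower semicontinuous in $L^1_{loc}$
(`ballEnergy_le_liminf`), so it suffices to bound the energy of a locally Lipschitz $v$ by $\int g$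
for each weak upper gradient $g$. Averaging a Poincaré inequality over all balls of radius
$2\varepsilon$ does this (`ballEnergy_le_of_poincare`).

The assumed Poincaré inequality, however, concerns Lipschitz functions and `lip`, not weak upper
gradients. To pass over, enlarge $g$ slightly to a lower semicontinuous genuine upper gradient $h$,
take continuous $g_n\uparrow h+\eta$, and let $f_n(y)$ be the infimum of $v(x_0)+\sum
g_n(x_k)\,d(x_k,x_{k+1})$ over chains with steps at most $1/(n+1)$ ending at $y$. For bounded $v\ge
0$, $f_n$ is Lipschitz with `lip` at most $g_n$. Also $f_n\uparrow v$: otherwise cheap chains, of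
bounded length because $g_n\ge\eta$, would subconverge in the proper space $X$ to a curve violating
the upper gradient inequality (`le_of_forall_exists_chain`). Fatou carries the inequality from $f_n$
to $v$, and then $\eta\to0$. -/

theorem IsDoublingWith.measure_ball_pos (h : IsDoublingWith cD μ) (x : X) {r : ℝ} (hr : 0 < r) :
    0 < μ (ball x r) := by
  simpa [mul_div_cancel₀] using h.ball_pos x (r / 2) (by positivity)

theorem IsDoublingWith.measure_ball_ne_zero (h : IsDoublingWith cD μ) (x : X) {r : ℝ}
    (hr : 0 < r) : μ (ball x r) ≠ 0 :=
  (h.measure_ball_pos x hr).ne'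

theorem IsDoublingWith.measure_ball_ne_top (h : IsDoublingWith cD μ) (x : X) (r : ℝ) :
    μ (ball x r) ≠ ∞ := by
  rcases le_or_gt r 0 with hr | hr
  · simp [ball_eq_empty.2 hr]
  · exact (h.ball_lt_top x r hr).ne

theorem IsDoublingWith.one_le_ofReal (h : IsDoublingWith cD μ) : 1 ≤ ENNReal.ofReal cD :=
  ENNReal.one_le_ofReal.2 h.one_le

theorem IsDoublingWith.measure_ball_two_pow_mul_le (h : IsDoublingWith cD μ) (x : X) {r : ℝ}
    (hr : 0 < r) (k : ℕ) :
    μ (ball x (2 ^ k * r)) ≤ ENNReal.ofReal cD ^ k * μ (ball x r) := by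
  induction k with
  | zero => simp
  | succ k ih =>
    calc μ (ball x (2 ^ (k + 1) * r)) = μ (ball x (2 * (2 ^ k * r))) := by ring_nf
      _ ≤ ENNReal.ofReal cD * μ (ball x (2 ^ k * r)) := h.ball_le x _ (by positivity)
      _ ≤ ENNReal.ofReal cD * (ENNReal.ofReal cD ^ k * μ (ball x r)) := by gcongr
      _ = ENNReal.ofReal cD ^ (k + 1) * μ (ball x r) := by rw [pow_succ']; ring

/-- Balls with comparable radii and centers have comparable measures. -/
theorem IsDoublingWith.measure_ball_le_of_dist (h : IsDoublingWith cD μ) {x y : X} {r s : ℝ}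
    (hr : 0 < r) (k : ℕ) (hs : dist x y + s ≤ 2 ^ k * r) :
    μ (ball y s) ≤ ENNReal.ofReal cD ^ k * μ (ball x r) := by
  refine le_trans (measure_mono (ball_subset_ball' ?_)) (h.measure_ball_two_pow_mul_le x hr k)
  rw [dist_comm]
  linarith

/-- Otherwise the ball contains an infinite $\varepsilon$-separated sequence. The disjoint balls of
radius $\varepsilon/2$ around it all carry at least a fixed fraction of $\mu(B_R(x))$ by doubling,
yet lie in one ball of finite measure. -/
theorem IsDoublingWith.totallyBounded_ball [BorelSpace X] (h : IsDoublingWith cD μ) (x : X)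
    (R : ℝ) : TotallyBounded (ball x R) := by
  rcases le_or_gt R 0 with hR | hR
  · simp [ball_eq_empty.2 hR]
  by_contra hnot
  rw [Metric.totallyBounded_iff] at hnot
  push Not at hnot
  obtain ⟨ε, hε, hcov⟩ := hnot
  have hstep : ∀ t : Finset X, ∃ y ∈ ball x R, ∀ z ∈ t, ε ≤ dist y z := by
    intro t
    have := hcov t t.finite_toSet
    rw [not_subset] at this
    obtain ⟨y, hy, hyt⟩ := this
    refine ⟨y, hy, fun z hz => ?_⟩
    by_contra! hlt
    exact hyt (mem_iUnion₂.2 ⟨z, hz, hlt⟩)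
  have : Std.Symm (fun a b : X => ε ≤ dist b a) := ⟨fun a b hab => by rwa [dist_comm]⟩
  obtain ⟨f, hfmem, hfsep⟩ := exists_seq_of_forall_finset_exists' (fun y => y ∈ ball x R)
    (fun a b => ε ≤ dist b a) (fun t _ => hstep t)
  obtain ⟨k, hk⟩ : ∃ k : ℕ, 2 * R < 2 ^ k * (ε / 2) := by
    obtain ⟨k, hk⟩ := pow_unbounded_of_one_lt (2 * R / (ε / 2)) (one_lt_two : (1 : ℝ) < 2)
    exact ⟨k, by rwa [div_lt_iff₀ (by positivity)] at hk⟩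
  have hD : ENNReal.ofReal cD ^ k ≠ 0 :=
    pow_ne_zero _ (zero_lt_one.trans_le h.one_le_ofReal).ne'
  have hD' : ENNReal.ofReal cD ^ k ≠ ∞ := ENNReal.pow_ne_top ENNReal.ofReal_ne_top
  have hlow : ∀ n, μ (ball x R) / ENNReal.ofReal cD ^ k ≤ μ (ball (f n) (ε / 2)) := by
    intro n
    rw [ENNReal.div_le_iff hD hD', mul_comm]
    have := hfmem n
    rw [mem_ball] at this
    exact h.measure_ball_le_of_dist (by positivity) k (by linarith)
  have hdisj : Pairwise (Function.onFun Disjoint fun n => ball (f n) (ε / 2)) := by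
    intro m n hmn
    refine ball_disjoint_ball ?_
    have := hfsep hmn.symm
    linarith
  have hfin := Measure.finite_const_le_meas_of_disjoint_iUnion μ
    (ε := μ (ball x R) / ENNReal.ofReal cD ^ k)
    (ENNReal.div_pos (h.measure_ball_ne_zero x hR) hD') (fun n => measurableSet_ball) hdisj
    (ne_top_of_le_ne_top (h.measure_ball_ne_top x (R + ε / 2)) (measure_mono
      (iUnion_subset fun n => ball_subset_ball' (by
        have := hfmem n
        rw [mem_ball] at this
        linarith))))
  exact infinite_univ (hfin.subset fun n _ => hlow n)

theorem IsDoublingWith.properSpace [BorelSpace X] [CompleteSpace X] (h : IsDoublingWith cD μ) :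
    ProperSpace X := by
  refine ⟨fun x r => isCompact_iff_totallyBounded_isComplete.2 ⟨?_, isClosed_closedBall.isComplete⟩⟩
  exact (h.totallyBounded_ball x (r + 1)).subset (closedBall_subset_ball (by linarith))

/-- With properness this yields the σ-finiteness and regularity of `μ` behind Tonelli and the
Vitali–Carathéodory theorem. -/
theorem IsDoublingWith.isLocallyFiniteMeasure (h : IsDoublingWith cD μ) :
    IsLocallyFiniteMeasure μ :=
  ⟨fun x => ⟨ball x 1, ball_mem_nhds x one_pos, h.ball_lt_top x 1 one_pos⟩⟩

/-- The indicator of the symmetric set $d<r$ turns measurability and exchange of iterated ball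
integrals into instances of Tonelli. -/
theorem setLIntegral_ball_eq [BorelSpace X] (f : X → X → ℝ≥0∞) (x : X) (r : ℝ) :
    ∫⁻ y in ball x r, f x y ∂μ
      = ∫⁻ y, {p : X × X | dist p.1 p.2 < r}.indicator (fun p => f p.1 p.2) (x, y) ∂μ := by
  rw [← lintegral_indicator measurableSet_ball]
  congr 1 with y
  simp only [indicator, mem_ball, mem_ofPred_eq, dist_comm]

section SecondCountable

variable [BorelSpace X] [SecondCountableTopology X] [SFinite μ]

theorem measurableSet_dist_lt (r : ℝ) : MeasurableSet {p : X × X | dist p.1 p.2 < r} :=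
  measurableSet_lt measurable_dist measurable_const

theorem measurable_measure_ball (r : ℝ) : Measurable fun x => μ (ball x r) := by
  have := measurable_measure_prodMk_left (ν := μ) (measurableSet_dist_lt (X := X) r)
  convert this using 3 with x
  ext y
  simp [dist_comm]

theorem measurable_setLIntegral_ball {f : X → X → ℝ≥0∞} (hf : Measurable (Function.uncurry f))
    (r : ℝ) : Measurable fun x => ∫⁻ y in ball x r, f x y ∂μ := by
  simp_rw [setLIntegral_ball_eq]
  exact (hf.indicator (measurableSet_dist_lt r)).lintegral_prod_right'

theorem lintegral_setLIntegral_ball_swap {f : X → X → ℝ≥0∞}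
    (hf : Measurable (Function.uncurry f)) (r : ℝ) :
    ∫⁻ x, ∫⁻ y in ball x r, f x y ∂μ ∂μ = ∫⁻ y, ∫⁻ x in ball y r, f x y ∂μ ∂μ := by
  simp_rw [setLIntegral_ball_eq]
  rw [lintegral_lintegral_swap]
  · refine lintegral_congr fun y => ?_
    rw [setLIntegral_ball_eq (fun a b => f b a)]
    simp only [indicator, mem_ofPred_eq, dist_comm]
  · exact (hf.indicator (measurableSet_dist_lt r)).aemeasurable

/-- Ball averaging is bounded on $L^1$: after Tonelli, $w(y)$ is multiplied by the integral of
$1/\mu(B_\varepsilon(x))$ over $x\in B_\rho(y)$. There $B_\rho(y)\subseteq B_{2\rho}(x)\subseteq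
B_{2^k\varepsilon}(x)$, so doubling bounds that factor. -/
theorem IsDoublingWith.lintegral_inv_measure_ball_mul_le (h : IsDoublingWith cD μ) {ε ρ : ℝ}
    (hε : 0 < ε) (k : ℕ) (hk : 2 * ρ ≤ 2 ^ k * ε) {w : X → ℝ≥0∞} (hw : Measurable w) :
    ∫⁻ x, (μ (ball x ε))⁻¹ * ∫⁻ y in ball x ρ, w y ∂μ ∂μ
      ≤ ENNReal.ofReal cD ^ k * ∫⁻ y, w y ∂μ := by
  have hm : Measurable (Function.uncurry fun x y => (μ (ball x ε))⁻¹ * w y) :=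
    ((measurable_measure_ball ε).inv.comp measurable_fst).mul (hw.comp measurable_snd)
  calc ∫⁻ x, (μ (ball x ε))⁻¹ * ∫⁻ y in ball x ρ, w y ∂μ ∂μ
      = ∫⁻ x, ∫⁻ y in ball x ρ, (μ (ball x ε))⁻¹ * w y ∂μ ∂μ := by
        refine lintegral_congr fun x => ?_
        rw [lintegral_const_mul _ hw]
    _ = ∫⁻ y, ∫⁻ x in ball y ρ, (μ (ball x ε))⁻¹ * w y ∂μ ∂μ :=
        lintegral_setLIntegral_ball_swap hm ρ
    _ ≤ ∫⁻ y, ENNReal.ofReal cD ^ k * w y ∂μ := by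
        refine lintegral_mono fun y => ?_
        rw [lintegral_mul_const (w y) (f := fun x => (μ (ball x ε))⁻¹) (measurable_measure_ball ε).inv]
        gcongr
        rcases le_or_gt ρ 0 with hρ | hρ
        · simp [ball_eq_empty.2 hρ]
        calc ∫⁻ x in ball y ρ, (μ (ball x ε))⁻¹ ∂μ
            ≤ ∫⁻ x in ball y ρ, ENNReal.ofReal cD ^ k * (μ (ball y ρ))⁻¹ ∂μ := by
              refine setLIntegral_mono' measurableSet_ball fun x hx => ?_
              have hle : μ (ball y ρ) ≤ ENNReal.ofReal cD ^ k * μ (ball x ε) := by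
                rw [mem_ball] at hx
                exact h.measure_ball_le_of_dist hε k (by linarith)
              rw [← div_eq_mul_inv, ENNReal.le_div_iff_mul_le
                (Or.inl (h.measure_ball_ne_zero y hρ)) (Or.inl (h.measure_ball_ne_top y ρ)),
                mul_comm, ← div_eq_mul_inv]
              exact ENNReal.div_le_of_le_mul hle
          _ = ENNReal.ofReal cD ^ k := by
              rw [setLIntegral_const, mul_assoc, ENNReal.inv_mul_cancel
                (h.measure_ball_ne_zero y hρ) (h.measure_ball_ne_top y ρ), mul_one]
    _ = ENNReal.ofReal cD ^ k * ∫⁻ y, w y ∂μ := lintegral_const_mul _ hw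

end SecondCountable

end NearDiagonal

/-! ### The energy with asymmetric weight: comparison, semicontinuity, Poincaré bound -/

namespace NearDiagonal

/-- The near-diagonal energy with the asymmetric weight `1 / μ(B_ε(x))`. -/
noncomputable def ballEnergy {X : Type*} [MetricSpace X] [MeasurableSpace X]
    (μ : Measure X) (u : X → ℝ) (ε : ℝ) : ℝ≥0∞ :=
  ENNReal.ofReal (1 / ε) *
    ∫⁻ x, (μ (ball x ε))⁻¹ * ∫⁻ y in ball x ε, ENNReal.ofReal |u x - u y| ∂μ ∂μ

variable {X : Type*} [MetricSpace X] [MeasurableSpace X] {μ : Measure X} {cD : ℝ}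

theorem IsDoublingWith.measureReal_ball_pos (h : IsDoublingWith cD μ) (x : X) {r : ℝ}
    (hr : 0 < r) : 0 < μ.real (ball x r) :=
  ENNReal.toReal_pos (h.measure_ball_ne_zero x hr) (h.measure_ball_ne_top x r)

theorem IsDoublingWith.measureReal_ball_le_of_dist (h : IsDoublingWith cD μ) {x y : X} {r s : ℝ}
    (hr : 0 < r) (k : ℕ) (hs : dist x y + s ≤ 2 ^ k * r) :
    μ.real (ball y s) ≤ cD ^ k * μ.real (ball x r) := by
  have h0 : 0 ≤ cD := zero_le_one.trans h.one_le
  have := ENNReal.toReal_mono (by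
    finiteness [h.measure_ball_ne_top x r]) (h.measure_ball_le_of_dist hr k hs)
  rwa [ENNReal.toReal_mul, ENNReal.toReal_pow, ENNReal.toReal_ofReal h0] at this

/-- Doubling gives the factor $\sqrt{c_D}$; as $c_D\ge1$, the weaker factor $c_D$ keeps roots out of
the constants. -/
theorem IsDoublingWith.sqrt_measureReal_ball_le (h : IsDoublingWith cD μ) {x y : X} {ε : ℝ}
    (hxy : dist x y < ε) :
    √(μ.real (ball x ε)) ≤ cD * √(μ.real (ball y ε)) := by
  have hε : 0 < ε := dist_nonneg.trans_lt hxy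
  have h0 : 0 ≤ cD := zero_le_one.trans h.one_le
  have h1 := h.measureReal_ball_le_of_dist (x := y) (y := x) (s := ε) hε 1
    (by rw [dist_comm]; linarith)
  rw [pow_one] at h1
  rw [Real.sqrt_le_left (by positivity), mul_pow, Real.sq_sqrt measureReal_nonneg]
  refine h1.trans ?_
  gcongr
  nlinarith [h.one_le]

theorem IsDoublingWith.inv_measure_ball (h : IsDoublingWith cD μ) (x : X) {ε : ℝ} (hε : 0 < ε) :
    (μ (ball x ε))⁻¹ = ENNReal.ofReal (1 / μ.real (ball x ε)) := by
  rw [one_div, ENNReal.ofReal_inv_of_pos (h.measureReal_ball_pos x hε), measureReal_def,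
    ENNReal.ofReal_toReal (h.measure_ball_ne_top x ε)]

theorem IsDoublingWith.div_sqrt_le (h : IsDoublingWith cD μ) {x y : X} {ε : ℝ}
    (hxy : dist x y < ε) {a : ℝ} (ha : 0 ≤ a) :
    ENNReal.ofReal (a / (√(μ.real (ball x ε)) * √(μ.real (ball y ε))))
      ≤ ENNReal.ofReal cD * ((μ (ball x ε))⁻¹ * ENNReal.ofReal a) := by
  have hε : 0 < ε := dist_nonneg.trans_lt hxy
  have h0 : 0 ≤ cD := zero_le_one.trans h.one_le
  rw [h.inv_measure_ball x hε, ← ENNReal.ofReal_mul (by positivity), ← ENNReal.ofReal_mul h0]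
  refine ENNReal.ofReal_le_ofReal ?_
  have hx := Real.sqrt_pos.2 (h.measureReal_ball_pos x hε)
  have hy := Real.sqrt_pos.2 (h.measureReal_ball_pos y hε)
  have hxx := Real.mul_self_sqrt (measureReal_nonneg (μ := μ) (s := ball x ε))
  have hle := h.sqrt_measureReal_ball_le hxy
  generalize √(μ.real (ball x ε)) = s at *
  generalize √(μ.real (ball y ε)) = t at *
  rw [← hxx, show cD * (1 / (s * s) * a) = (cD * a) / (s * s) by ring,
    div_le_div_iff₀ (by positivity) (by positivity)]
  have := mul_le_mul_of_nonneg_left hle (mul_nonneg ha hx.le)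
  linarith

theorem IsDoublingWith.le_div_sqrt (h : IsDoublingWith cD μ) {x y : X} {ε : ℝ}
    (hxy : dist x y < ε) {a : ℝ} (ha : 0 ≤ a) :
    (μ (ball x ε))⁻¹ * ENNReal.ofReal a
      ≤ ENNReal.ofReal cD *
        ENNReal.ofReal (a / (√(μ.real (ball x ε)) * √(μ.real (ball y ε)))) := by
  have hε : 0 < ε := dist_nonneg.trans_lt hxy
  have h0 : 0 ≤ cD := zero_le_one.trans h.one_le
  rw [h.inv_measure_ball x hε, ← ENNReal.ofReal_mul (by positivity), ← ENNReal.ofReal_mul h0]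
  refine ENNReal.ofReal_le_ofReal ?_
  have hx := Real.sqrt_pos.2 (h.measureReal_ball_pos x hε)
  have hy := Real.sqrt_pos.2 (h.measureReal_ball_pos y hε)
  have hxx := Real.mul_self_sqrt (measureReal_nonneg (μ := μ) (s := ball x ε))
  have hle := h.sqrt_measureReal_ball_le ((dist_comm y x).trans_lt hxy)
  generalize √(μ.real (ball x ε)) = s at *
  generalize √(μ.real (ball y ε)) = t at *
  rw [← hxx, ← mul_div_assoc, one_div_mul_eq_div, div_le_div_iff₀ (by positivity) (by positivity)]
  have := mul_le_mul_of_nonneg_left hle (mul_nonneg ha hx.le)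
  linarith

theorem measurable_ofReal_abs_sub {Y : Type*} [MeasurableSpace Y] {u : Y → ℝ} (hu : Measurable u) :
    Measurable (Function.uncurry fun x y => ENNReal.ofReal |u x - u y|) := by
  have : Measurable fun p : Y × Y => u p.1 - u p.2 := by fun_prop
  exact ENNReal.measurable_ofReal.comp (continuous_abs.measurable.comp this)

theorem lintegral_setLIntegral_ball_mono_mul [BorelSpace X] {f g : X → X → ℝ≥0∞} {c : ℝ≥0∞} (hc : c ≠ ∞) {ε : ℝ}
    (hfg : ∀ x y, dist x y < ε → f x y ≤ c * g x y) :
    ∫⁻ x, ∫⁻ y in ball x ε, f x y ∂μ ∂μ ≤ c * ∫⁻ x, ∫⁻ y in ball x ε, g x y ∂μ ∂μ := by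
  rw [← lintegral_const_mul' _ _ hc]
  refine lintegral_mono fun x => ?_
  rw [← lintegral_const_mul' _ _ hc]
  exact setLIntegral_mono' measurableSet_ball fun y hy => hfg x y (mem_ball'.1 hy)

theorem ballEnergy_eq {u : X → ℝ} (hu : Measurable u) (ε : ℝ) :
    ballEnergy μ u ε = ENNReal.ofReal (1 / ε) *
      ∫⁻ x, ∫⁻ y in ball x ε, (μ (ball x ε))⁻¹ * ENNReal.ofReal |u x - u y| ∂μ ∂μ := by
  rw [ballEnergy]
  congr 1
  refine lintegral_congr fun x => ?_
  exact (lintegral_const_mul _ ((measurable_ofReal_abs_sub hu).comp measurable_prodMk_left)).symm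

section SecondCountable

variable [BorelSpace X] [SecondCountableTopology X] [SFinite μ]

theorem nearDiagonalEnergy_eq {u : X → ℝ} (hu : Measurable u) (ε : ℝ) :
    nearDiagonalEnergy μ u ε = ENNReal.ofReal (1 / ε) *
      ∫⁻ x, ∫⁻ y in ball x ε,
        ENNReal.ofReal (|u x - u y| / (√(μ.real (ball x ε)) * √(μ.real (ball y ε)))) ∂μ ∂μ := by
  have hm : Measurable fun x => √(μ.real (ball x ε)) :=
    Real.continuous_sqrt.measurable.comp (measurable_measure_ball ε).ennreal_toReal
  have hf : Measurable fun p : X × X => ENNReal.ofReal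
      (|u p.1 - u p.2| / (√(μ.real (ball p.1 ε)) * √(μ.real (ball p.2 ε)))) := by
    refine ENNReal.measurable_ofReal.comp (Measurable.div ?_
      ((hm.comp measurable_fst).mul (hm.comp measurable_snd)))
    exact continuous_abs.measurable.comp (by fun_prop)
  rw [nearDiagonalEnergy, ← lintegral_indicator (measurableSet_dist_lt ε),
    lintegral_prod _ (hf.indicator (measurableSet_dist_lt ε)).aemeasurable]
  congr 1
  refine lintegral_congr fun x => ?_
  rw [setLIntegral_ball_eq fun x y =>
    ENNReal.ofReal (|u x - u y| / (√(μ.real (ball x ε)) * √(μ.real (ball y ε))))]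

theorem IsDoublingWith.nearDiagonalEnergy_le_ballEnergy (h : IsDoublingWith cD μ) {u : X → ℝ}
    (hu : Measurable u) (ε : ℝ) :
    nearDiagonalEnergy μ u ε ≤ ENNReal.ofReal cD * ballEnergy μ u ε := by
  rw [nearDiagonalEnergy_eq hu, ballEnergy_eq hu, mul_left_comm]
  gcongr
  exact lintegral_setLIntegral_ball_mono_mul ENNReal.ofReal_ne_top
    fun x y hxy => h.div_sqrt_le hxy (abs_nonneg _)

theorem IsDoublingWith.ballEnergy_le_nearDiagonalEnergy (h : IsDoublingWith cD μ) {u : X → ℝ}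
    (hu : Measurable u) (ε : ℝ) :
    ballEnergy μ u ε ≤ ENNReal.ofReal cD * nearDiagonalEnergy μ u ε := by
  rw [nearDiagonalEnergy_eq hu, ballEnergy_eq hu, mul_left_comm]
  gcongr
  exact lintegral_setLIntegral_ball_mono_mul ENNReal.ofReal_ne_top
    fun x y hxy => h.le_div_sqrt hxy (abs_nonneg _)

/-- Triangle inequality: with $w=|v-u|$, the difference of $u$ is at most that of $v$ plus
$w(x)+w(y)$. The term $w(x)$ averages to itself, and $w(y)$ costs a factor $c_D$. Since $y$ stays in
$B_{R+\varepsilon}(x_0)$, only local $L^1$ control of $w$ is needed. -/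
theorem IsDoublingWith.setLIntegral_ballEnergy_le (h : IsDoublingWith cD μ) {u v : X → ℝ}
    (hu : Measurable u) (hv : Measurable v) {ε : ℝ} (hε : 0 < ε) (x₀ : X) (R : ℝ) :
    ∫⁻ x in ball x₀ R, (μ (ball x ε))⁻¹ * ∫⁻ y in ball x ε, ENNReal.ofReal |u x - u y| ∂μ ∂μ
      ≤ ∫⁻ x, (μ (ball x ε))⁻¹ * ∫⁻ y in ball x ε, ENNReal.ofReal |v x - v y| ∂μ ∂μ
        + (1 + ENNReal.ofReal cD) * ∫⁻ y in ball x₀ (R + ε), ENNReal.ofReal |v y - u y| ∂μ := by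
  set w : X → ℝ≥0∞ := (ball x₀ (R + ε)).indicator fun y => ENNReal.ofReal |v y - u y| with hwdef
  have hw : Measurable w := Measurable.indicator
    (ENNReal.measurable_ofReal.comp (continuous_abs.measurable.comp (hv.sub hu)))
    measurableSet_ball
  have hwint : ∫⁻ y in ball x₀ (R + ε), ENNReal.ofReal |v y - u y| ∂μ = ∫⁻ y, w y ∂μ := by
    rw [hwdef, lintegral_indicator measurableSet_ball]
  have hVm : Measurable fun x =>
      (μ (ball x ε))⁻¹ * ∫⁻ y in ball x ε, ENNReal.ofReal |v x - v y| ∂μ :=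
    (measurable_measure_ball ε).inv.mul
      (measurable_setLIntegral_ball (measurable_ofReal_abs_sub hv) ε)
  have hpt : ∀ x ∈ ball x₀ R,
      (μ (ball x ε))⁻¹ * ∫⁻ y in ball x ε, ENNReal.ofReal |u x - u y| ∂μ
        ≤ (μ (ball x ε))⁻¹ * ∫⁻ y in ball x ε, ENNReal.ofReal |v x - v y| ∂μ
          + (w x + (μ (ball x ε))⁻¹ * ∫⁻ y in ball x ε, w y ∂μ) := by
    intro x hx
    have hwx : w x = ENNReal.ofReal |v x - u x| :=
      indicator_of_mem (ball_subset_ball (by linarith) hx) _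
    have hvm : Measurable fun y => ENNReal.ofReal |v x - v y| :=
      (measurable_ofReal_abs_sub hv).comp measurable_prodMk_left
    calc (μ (ball x ε))⁻¹ * ∫⁻ y in ball x ε, ENNReal.ofReal |u x - u y| ∂μ
        ≤ (μ (ball x ε))⁻¹ *
            ∫⁻ y in ball x ε, (ENNReal.ofReal |v x - v y| + (w x + w y)) ∂μ := by
          refine mul_le_mul' le_rfl (setLIntegral_mono' measurableSet_ball fun y hy => ?_)
          have hy' : y ∈ ball x₀ (R + ε) := by
            rw [mem_ball] at hx hy ⊢
            linarith [dist_triangle y x x₀]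
          have hwy : w y = ENNReal.ofReal |v y - u y| := indicator_of_mem hy' _
          rw [hwx, hwy, ← ENNReal.ofReal_add (abs_nonneg _) (abs_nonneg _),
            ← ENNReal.ofReal_add (abs_nonneg _) (by positivity)]
          refine ENNReal.ofReal_le_ofReal ?_
          have e : u x - u y = (v x - v y) + (-(v x - u x) + (v y - u y)) := by ring
          rw [e]
          refine (abs_add_le _ _).trans (add_le_add le_rfl ((abs_add_le _ _).trans ?_))
          rw [abs_neg]
      _ = _ := by
          rw [lintegral_add_left hvm, lintegral_add_left measurable_const, setLIntegral_const,
            mul_add, mul_add, mul_comm (w x), ← mul_assoc,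
            ENNReal.inv_mul_cancel (h.measure_ball_ne_zero x hε) (h.measure_ball_ne_top x ε),
            one_mul]
  calc _ ≤ ∫⁻ x in ball x₀ R,
        ((μ (ball x ε))⁻¹ * ∫⁻ y in ball x ε, ENNReal.ofReal |v x - v y| ∂μ
          + (w x + (μ (ball x ε))⁻¹ * ∫⁻ y in ball x ε, w y ∂μ)) ∂μ :=
        setLIntegral_mono' measurableSet_ball hpt
    _ ≤ ∫⁻ x, ((μ (ball x ε))⁻¹ * ∫⁻ y in ball x ε, ENNReal.ofReal |v x - v y| ∂μ
          + (w x + (μ (ball x ε))⁻¹ * ∫⁻ y in ball x ε, w y ∂μ)) ∂μ :=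
        setLIntegral_le_lintegral _ _
    _ = ∫⁻ x, (μ (ball x ε))⁻¹ * ∫⁻ y in ball x ε, ENNReal.ofReal |v x - v y| ∂μ ∂μ
          + (∫⁻ x, w x ∂μ + ∫⁻ x, (μ (ball x ε))⁻¹ * ∫⁻ y in ball x ε, w y ∂μ ∂μ) := by
        rw [lintegral_add_left hVm, lintegral_add_left hw]
    _ ≤ _ := by
        rw [hwint, add_mul, one_mul]
        gcongr
        simpa using h.lintegral_inv_measure_ball_mul_le hε 1 (by simp) hw

/-- Lower semicontinuity of the near-diagonal energy under `L¹_loc`-convergence. -/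
theorem IsDoublingWith.ballEnergy_le_liminf (h : IsDoublingWith cD μ) {u : X → ℝ}
    (hu : Measurable u) {v : ℕ → X → ℝ} (hv : ∀ j, Measurable (v j))
    (hvu : TendstoL1Loc μ v u) {ε : ℝ} (hε : 0 < ε) :
    ballEnergy μ u ε ≤ liminf (fun j => ballEnergy μ (v j) ε) atTop := by
  rcases isEmpty_or_nonempty X with hX | ⟨⟨x₀⟩⟩
  · simp [ballEnergy, Measure.eq_zero_of_isEmpty μ]
  have hdir : Directed (· ⊆ ·) fun n : ℕ => ball x₀ (n : ℝ) :=
    (monotone_nat_of_le_succ fun n => ball_subset_ball (by simp)).directed_le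
  have hc : ENNReal.ofReal (1 / ε) * (1 + ENNReal.ofReal cD) ≠ ∞ := by finiteness
  -- Convergence is only local, so the outer integral is exhausted by the balls $B_n(x_0)$; on each
  -- one the error term tends to zero.
  rw [ballEnergy, ← setLIntegral_univ, ← iUnion_ball_nat x₀,
    setLIntegral_iUnion_of_directed _ hdir, ENNReal.mul_iSup]
  refine iSup_le fun n => ?_
  have hlim : Tendsto (fun j => ENNReal.ofReal (1 / ε) * (1 + ENNReal.ofReal cD) *
      ∫⁻ y in ball x₀ (n + ε), ENNReal.ofReal |v j y - u y| ∂μ) atTop (𝓝 0) := by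
    simpa using ENNReal.Tendsto.const_mul (hvu x₀ (n + ε) (by positivity)) (Or.inr hc)
  rw [← ENNReal.liminf_add_of_right_tendsto_zero hlim]
  refine le_liminf_of_le (by isBoundedDefault) (Eventually.of_forall fun j => ?_)
  calc _ ≤ _ := mul_le_mul_right (h.setLIntegral_ballEnergy_le hu (hv j) hε x₀ n) _
    _ = _ := by rw [mul_add, ← mul_assoc, Pi.add_apply, ballEnergy]

/-- No covering is needed: insert the mean over $z\in B_\varepsilon(x)$ of the constant 1 and
exchange $x$ and $z$. Then $B_\varepsilon(x)\subseteq B_{2\varepsilon}(z)$, and the Poincaré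
inequality on $B_{2\varepsilon}(z)$ applies for every $z$. The factor $D^k$ comes from averaging $g$
over $B_{2\lambda\varepsilon}(z)$, whence the condition $4\lambda\le2^k$. -/
theorem IsDoublingWith.ballEnergy_le_of_poincare (h : IsDoublingWith cD μ) {v : X → ℝ}
    (hv : Measurable v) {g : X → ℝ≥0∞} (hg : Measurable g) {cP lam : ℝ}
    (hP : ∀ (z : X) (r : ℝ), 0 < r →
      ∫⁻ x in ball z r, ∫⁻ y in ball z r, ENNReal.ofReal |v x - v y| ∂μ ∂μ
        ≤ 2 * μ (ball z r) * (ENNReal.ofReal (cP * r) * ∫⁻ y in ball z (lam * r), g y ∂μ))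
    {k : ℕ} (hk : 4 * lam ≤ 2 ^ k) {ε : ℝ} (hε : 0 < ε) :
    ballEnergy μ v ε ≤ 2 * ENNReal.ofReal (cP * 2) * ENNReal.ofReal cD ^ (3 + k) *
      ∫⁻ x, g x ∂μ := by
  set D := ENNReal.ofReal cD with hD
  have hm := measurable_measure_ball (μ := μ) ε
  have hI := measurable_setLIntegral_ball (μ := μ) (measurable_ofReal_abs_sub hv) ε
  set I : X → ℝ≥0∞ := fun x => ∫⁻ y in ball x ε, ENNReal.ofReal |v x - v y| ∂μ with hIdef
  have hf : Measurable (Function.uncurry fun x (_ : X) =>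
      (μ (ball x ε))⁻¹ * ((μ (ball x ε))⁻¹ * I x)) :=
    (hm.inv.mul (hm.inv.mul hI)).comp measurable_fst
  have hinv : ∀ x z : X, dist x z < ε → (μ (ball x ε))⁻¹ ≤ D * (μ (ball z ε))⁻¹ := by
    intro x z hxz
    have := h.measure_ball_le_of_dist (x := x) (y := z) (s := ε) hε 1 (by linarith)
    rw [pow_one] at this
    rw [← div_eq_mul_inv, ENNReal.le_div_iff_mul_le
      (Or.inl (h.measure_ball_ne_zero z hε)) (Or.inl (h.measure_ball_ne_top z ε)),
      mul_comm, ← div_eq_mul_inv]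
    exact ENNReal.div_le_of_le_mul this
  -- The power $D^3$: two factors move the weights from $B_\varepsilon(x)$ to $B_\varepsilon(z)$,
  -- one comes from $\mu(B_{2\varepsilon}(z))$.
  have hz : ∀ z, ∫⁻ x in ball z ε, (μ (ball x ε))⁻¹ * ((μ (ball x ε))⁻¹ * I x) ∂μ
      ≤ 2 * ENNReal.ofReal (cP * (2 * ε)) * D ^ 3 *
        ((μ (ball z ε))⁻¹ * ∫⁻ y in ball z (lam * (2 * ε)), g y ∂μ) := by
    intro z
    have hz0 := h.measure_ball_ne_zero z hε
    have hzt := h.measure_ball_ne_top z ε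
    have h2 : μ (ball z (2 * ε)) ≤ D * μ (ball z ε) := h.ball_le z ε hε
    calc ∫⁻ x in ball z ε, (μ (ball x ε))⁻¹ * ((μ (ball x ε))⁻¹ * I x) ∂μ
        ≤ ∫⁻ x in ball z ε, (D * (μ (ball z ε))⁻¹) * ((D * (μ (ball z ε))⁻¹) *
            ∫⁻ y in ball z (2 * ε), ENNReal.ofReal |v x - v y| ∂μ) ∂μ := by
          refine setLIntegral_mono' measurableSet_ball fun x hx => ?_
          rw [mem_ball] at hx
          have hx' := hinv x z hx
          gcongr
          refine lintegral_mono_set (ball_subset_ball' ?_)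
          linarith
      _ ≤ ∫⁻ x in ball z (2 * ε), (D * (μ (ball z ε))⁻¹) * ((D * (μ (ball z ε))⁻¹) *
            ∫⁻ y in ball z (2 * ε), ENNReal.ofReal |v x - v y| ∂μ) ∂μ :=
          lintegral_mono_set (ball_subset_ball (by linarith))
      _ = (D * (μ (ball z ε))⁻¹) * ((D * (μ (ball z ε))⁻¹) * ∫⁻ x in ball z (2 * ε),
            ∫⁻ y in ball z (2 * ε), ENNReal.ofReal |v x - v y| ∂μ ∂μ) := by
          have : D * (μ (ball z ε))⁻¹ ≠ ∞ :=
            ENNReal.mul_ne_top ENNReal.ofReal_ne_top (ENNReal.inv_ne_top.2 hz0)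
          rw [lintegral_const_mul' _ _ this, lintegral_const_mul' _ _ this]
      _ ≤ (D * (μ (ball z ε))⁻¹) * ((D * (μ (ball z ε))⁻¹) * (2 * (D * μ (ball z ε)) *
            (ENNReal.ofReal (cP * (2 * ε)) * ∫⁻ y in ball z (lam * (2 * ε)), g y ∂μ))) := by
          gcongr
          refine (hP z (2 * ε) (by positivity)).trans ?_
          gcongr
      _ = 2 * ENNReal.ofReal (cP * (2 * ε)) * D ^ 3 * (((μ (ball z ε))⁻¹ * μ (ball z ε)) *
            ((μ (ball z ε))⁻¹ * ∫⁻ y in ball z (lam * (2 * ε)), g y ∂μ)) := by ring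
      _ = _ := by rw [ENNReal.inv_mul_cancel hz0 hzt, one_mul]
  have hmain : ∫⁻ x, (μ (ball x ε))⁻¹ * I x ∂μ
      ≤ 2 * ENNReal.ofReal (cP * (2 * ε)) * D ^ 3 * (D ^ k * ∫⁻ x, g x ∂μ) := by
    calc ∫⁻ x, (μ (ball x ε))⁻¹ * I x ∂μ
        = ∫⁻ x, ∫⁻ _z in ball x ε, (μ (ball x ε))⁻¹ * ((μ (ball x ε))⁻¹ * I x) ∂μ ∂μ := by
          refine lintegral_congr fun x => ?_
          rw [setLIntegral_const, mul_comm _ (μ (ball x ε)), ← mul_assoc,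
            ENNReal.mul_inv_cancel (h.measure_ball_ne_zero x hε) (h.measure_ball_ne_top x ε),
            one_mul]
      _ = ∫⁻ z, ∫⁻ x in ball z ε, (μ (ball x ε))⁻¹ * ((μ (ball x ε))⁻¹ * I x) ∂μ ∂μ :=
          lintegral_setLIntegral_ball_swap hf ε
      _ ≤ ∫⁻ z, 2 * ENNReal.ofReal (cP * (2 * ε)) * D ^ 3 *
            ((μ (ball z ε))⁻¹ * ∫⁻ y in ball z (lam * (2 * ε)), g y ∂μ) ∂μ :=
          lintegral_mono hz
      _ = 2 * ENNReal.ofReal (cP * (2 * ε)) * D ^ 3 *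
            ∫⁻ z, (μ (ball z ε))⁻¹ * ∫⁻ y in ball z (lam * (2 * ε)), g y ∂μ ∂μ :=
          lintegral_const_mul' _ _ (by finiteness)
      _ ≤ _ := by
          gcongr
          refine h.lintegral_inv_measure_ball_mul_le hε k ?_ hg
          nlinarith
  calc ballEnergy μ v ε = ENNReal.ofReal (1 / ε) * ∫⁻ x, (μ (ball x ε))⁻¹ * I x ∂μ := rfl
    _ ≤ ENNReal.ofReal (1 / ε) *
        (2 * ENNReal.ofReal (cP * (2 * ε)) * D ^ 3 * (D ^ k * ∫⁻ x, g x ∂μ)) := by gcongr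
    _ = 2 * (ENNReal.ofReal (1 / ε) * ENNReal.ofReal (cP * (2 * ε))) * D ^ (3 + k) *
        ∫⁻ x, g x ∂μ := by ring
    _ = _ := by
        rw [← ENNReal.ofReal_mul (by positivity)]
        congr 4
        field_simp

end SecondCountable

end NearDiagonal

/-! ### Upper gradients from oscillation bounds at a fixed scale -/

namespace NearDiagonal

section UpperGradient

variable {X : Type*} [MetricSpace X]

theorem RectifiableCurve.dist_le (γ : RectifiableCurve X) {s t : ℝ} (hs : s ∈ Icc 0 γ.length)
    (ht : t ∈ Icc 0 γ.length) (hst : s ≤ t) : dist (γ.toFun s) (γ.toFun t) ≤ t - s := by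
  have h := eVariationOn.edist_le γ.toFun (s := Icc 0 γ.length ∩ Icc s t)
    ⟨hs, le_rfl, hst⟩ ⟨ht, hst, le_rfl⟩
  rw [γ.unitSpeed hs ht, NNReal.coe_one, one_mul, edist_dist] at h
  exact (ENNReal.ofReal_le_ofReal_iff (sub_nonneg.2 hst)).1 h

/-- Both ends of an arc shorter than $\delta$ lie within $\delta$ of each of its points $\gamma(r)$,
so the difference quotient of $v$ over the arc is at most $G(\gamma(r))$ for every $r$; integrate in
$r$. A general curve is cut into arcs of length at most $\delta/2$. -/
theorem RectifiableCurve.ofReal_abs_sub_le (γ : RectifiableCurve X) {v : X → ℝ} {G : X → ℝ≥0∞}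
    {δ : ℝ} (hδ : 0 < δ) (hv : ∀ z x y, dist x z < δ → dist y z < δ →
      ENNReal.ofReal |v x - v y| ≤ G z * ENNReal.ofReal (dist x y)) :
    ENNReal.ofReal |v (γ.toFun 0) - v (γ.toFun γ.length)| ≤ γ.integral G := by
  have hshort : ∀ s t, 0 ≤ s → s ≤ t → t ≤ γ.length → t - s < δ →
      ENNReal.ofReal |v (γ.toFun s) - v (γ.toFun t)| ≤ ∫⁻ r in Ioc s t, G (γ.toFun r) := by
    intro s t hs hst ht hlt
    rcases hst.eq_or_lt with rfl | hst'
    · simp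
    have hs' : s ∈ Icc 0 γ.length := ⟨hs, hst.trans ht⟩
    have ht' : t ∈ Icc 0 γ.length := ⟨hs.trans hst, ht⟩
    have hd0 : ENNReal.ofReal (t - s) ≠ 0 := (ENNReal.ofReal_pos.2 (sub_pos.2 hst')).ne'
    calc ENNReal.ofReal |v (γ.toFun s) - v (γ.toFun t)|
        = ∫⁻ _r in Ioc s t, ENNReal.ofReal |v (γ.toFun s) - v (γ.toFun t)|
            / ENNReal.ofReal (t - s) := by
          rw [setLIntegral_const, Real.volume_Ioc,
            ENNReal.div_mul_cancel hd0 ENNReal.ofReal_ne_top]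
      _ ≤ ∫⁻ r in Ioc s t, G (γ.toFun r) := by
          refine setLIntegral_mono' measurableSet_Ioc fun r hr => ?_
          have hr' : r ∈ Icc 0 γ.length := ⟨hs.trans hr.1.le, hr.2.trans ht⟩
          refine ENNReal.div_le_of_le_mul ((hv (γ.toFun r) _ _ ?_ ?_).trans ?_)
          · exact (γ.dist_le hs' hr' hr.1.le).trans_lt (by linarith [hr.2])
          · rw [dist_comm]
            exact (γ.dist_le hr' ht' hr.2).trans_lt (by linarith [hr.1])
          · gcongr
            exact γ.dist_le hs' ht' hst
  have hind : ∀ n : ℕ, ∀ t, 0 ≤ t → t ≤ γ.length → t ≤ n * (δ / 2) →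
      ENNReal.ofReal |v (γ.toFun 0) - v (γ.toFun t)| ≤ ∫⁻ r in Ioc 0 t, G (γ.toFun r) := by
    intro n
    induction n with
    | zero =>
      intro t ht _ htn
      have : t = 0 := le_antisymm (by simpa using htn) ht
      simp [this]
    | succ n ih =>
      intro t ht htl htn
      rcases le_or_gt t (δ / 2) with hle | hlt
      · exact hshort 0 t le_rfl ht htl (by linarith)
      push_cast at htn
      have h1 := ih (t - δ / 2) (by linarith) (by linarith) (by linarith)
      have h2 := hshort (t - δ / 2) t (by linarith) (by linarith) htl (by linarith)
      calc ENNReal.ofReal |v (γ.toFun 0) - v (γ.toFun t)|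
          ≤ ENNReal.ofReal (|v (γ.toFun 0) - v (γ.toFun (t - δ / 2))|
              + |v (γ.toFun (t - δ / 2)) - v (γ.toFun t)|) :=
            ENNReal.ofReal_le_ofReal (abs_sub_le _ _ _)
        _ ≤ (∫⁻ r in Ioc 0 (t - δ / 2), G (γ.toFun r))
              + ∫⁻ r in Ioc (t - δ / 2) t, G (γ.toFun r) := by
            rw [ENNReal.ofReal_add (abs_nonneg _) (abs_nonneg _)]
            exact add_le_add h1 h2
        _ = ∫⁻ r in Ioc 0 t, G (γ.toFun r) := by
            rw [← lintegral_union measurableSet_Ioc (Ioc_disjoint_Ioc_of_le le_rfl),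
              Ioc_union_Ioc_eq_Ioc (by linarith) (by linarith)]
  obtain ⟨n, hn⟩ := exists_nat_ge (γ.length / (δ / 2))
  rw [div_le_iff₀ (by positivity)] at hn
  exact (hind n γ.length γ.length_pos.le le_rfl hn).trans (lintegral_mono_set Ioc_subset_Icc_self)

/-- The exceptional family is empty, so $\rho=0$ is admissible for its modulus. -/
theorem isWeakUpperGradient_of_forall [MeasurableSpace X] {μ : Measure X} {v : X → ℝ}
    {G : X → ℝ≥0∞} (hG : Measurable G) (hv : ∀ γ : RectifiableCurve X,
      ENNReal.ofReal |v (γ.toFun 0) - v (γ.toFun γ.length)| ≤ γ.integral G) :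
    IsWeakUpperGradient μ v G := by
  refine ⟨hG, nonpos_iff_eq_zero.1 ?_⟩
  refine (iInf₂_le (fun _ => 0) measurable_const).trans ?_
  refine (iInf_le _ fun γ hγ => absurd (hv γ) hγ).trans ?_
  simp

end UpperGradient

/-! ### Tent averages: finite energy implies bounded variation -/

section KernelAverage

variable {X : Type*} [MetricSpace X]

/-- The tent function of radius `δ` around `x`. -/
noncomputable def tent (δ : ℝ) (x y : X) : ℝ := max 0 (1 - dist x y / δ)

variable {δ : ℝ}

theorem tent_nonneg (x y : X) : 0 ≤ tent δ x y := le_max_left _ _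

theorem tent_le_one (hδ : 0 < δ) (x y : X) : tent δ x y ≤ 1 :=
  max_le zero_le_one (by have : 0 ≤ dist x y / δ := by positivity
                         linarith)

theorem tent_eq_zero (hδ : 0 < δ) {x y : X} (h : δ ≤ dist x y) : tent δ x y = 0 :=
  max_eq_left (by rw [sub_nonpos]; rwa [one_le_div hδ])

theorem half_le_tent (hδ : 0 < δ) {x y : X} (h : dist x y ≤ δ / 2) : 1 / 2 ≤ tent δ x y := by
  refine le_max_of_le_right ?_
  have : dist x y / δ ≤ 1 / 2 := by rw [div_le_iff₀ hδ]; linarith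
  linarith

theorem abs_tent_sub_tent_le (hδ : 0 < δ) (x x' y : X) :
    |tent δ x y - tent δ x' y| ≤ dist x x' / δ := by
  refine (abs_max_sub_max_le_max _ _ _ _).trans ?_
  rw [sub_self, abs_zero, max_eq_right (abs_nonneg _),
    show 1 - dist x y / δ - (1 - dist x' y / δ) = (dist x' y - dist x y) / δ by ring,
    abs_div, abs_of_pos hδ]
  gcongr
  rw [abs_sub_comm]
  exact abs_dist_sub_le x x' y

variable [MeasurableSpace X]

/-- The average of `u` with respect to the tent function of radius `δ`. -/
noncomputable def tentAverage (μ : Measure X) (u : X → ℝ) (δ : ℝ) (x : X) : ℝ :=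
  (∫ y, tent δ x y * u y ∂μ) / ∫ y, tent δ x y ∂μ

variable {μ : Measure X} {cD : ℝ}

theorem measurable_tent [OpensMeasurableSpace X] (x : X) : Measurable (tent δ x) := by
  have : Continuous (tent δ x) := by unfold tent; fun_prop
  exact this.measurable

theorem abs_integral_mul_le [OpensMeasurableSpace X] {z : X} {r a : ℝ} {φ f : X → ℝ}
    (hφ : ∀ y, |φ y| ≤ a) (hφ0 : ∀ y, r ≤ dist z y → φ y = 0)
    (hf : IntegrableOn f (ball z r) μ) :
    |∫ y, φ y * f y ∂μ| ≤ a * ∫ y in ball z r, |f y| ∂μ := by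
  rw [← integral_const_mul, ← integral_indicator measurableSet_ball]
  refine abs_integral_le_integral_abs.trans (integral_mono_of_nonneg
    (Eventually.of_forall fun y => abs_nonneg _) ?_ (Eventually.of_forall fun y => ?_))
  · exact (integrable_indicator_iff measurableSet_ball).2 (hf.abs.const_mul a)
  · by_cases hy : y ∈ ball z r
    · simp only [indicator_of_mem hy, abs_mul]
      gcongr
      exact hφ y
    · simp only [indicator_of_notMem hy]
      rw [hφ0 y (by rw [mem_ball, dist_comm] at hy; exact not_lt.1 hy)]
      simp

theorem IsDoublingWith.integrableOn_const (h : IsDoublingWith cD μ) (x : X) (r c : ℝ) :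
    IntegrableOn (fun _ => c) (ball x r) μ :=
  MeasureTheory.integrableOn_const (h.measure_ball_ne_top x r)

theorem IsDoublingWith.ofReal_mean_eq (h : IsDoublingWith cD μ) (hδ : 0 < δ) {u : X → ℝ}
    (hu : Integrable u μ) (z : X) :
    ENNReal.ofReal (1 / μ.real (ball z (2 * δ)) * ∫ y in ball z (2 * δ), |u y - u z| ∂μ)
      = (μ (ball z (2 * δ)))⁻¹ * ∫⁻ y in ball z (2 * δ), ENNReal.ofReal |u z - u y| ∂μ := by
  have hint : IntegrableOn (fun y => |u y - u z|) (ball z (2 * δ)) μ :=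
    (hu.integrableOn.sub (h.integrableOn_const z _ (u z))).abs
  rw [ENNReal.ofReal_mul (by positivity), ← h.inv_measure_ball z (by positivity),
    ofReal_integral_eq_lintegral_ofReal hint (Eventually.of_forall fun y => abs_nonneg _)]
  simp_rw [abs_sub_comm (u z)]

variable [BorelSpace X]

theorem integrable_tent_mul (hδ : 0 < δ) (x : X)
    {f : X → ℝ} (hf : IntegrableOn f (ball x δ) μ) :
    Integrable (fun y => tent δ x y * f y) μ := by
  have : (fun y => tent δ x y * f y) = (ball x δ).indicator fun y => tent δ x y * f y := by
    ext y
    by_cases hy : y ∈ ball x δ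
    · rw [indicator_of_mem hy]
    · rw [indicator_of_notMem hy, tent_eq_zero hδ (by simpa [dist_comm] using hy), zero_mul]
  rw [this, integrable_indicator_iff measurableSet_ball]
  refine hf.bdd_mul (c := 1) (measurable_tent x).aestronglyMeasurable
    (Eventually.of_forall fun y => ?_)
  rw [Real.norm_eq_abs, abs_of_nonneg (tent_nonneg x y)]
  exact tent_le_one hδ x y

theorem IsDoublingWith.integrable_tent (h : IsDoublingWith cD μ) (hδ : 0 < δ) (x : X) :
    Integrable (tent δ x) μ := by
  simpa using integrable_tent_mul hδ x (h.integrableOn_const x δ 1)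

/-- The tent is at least $1/2$ on $B_{\delta/2}(x)$, and $B_{2\delta}(z)\subseteq B_{4\delta}(x)$
with $4\delta=2^3\cdot\delta/2$. -/
theorem IsDoublingWith.measureReal_ball_le_integral_tent (h : IsDoublingWith cD μ) (hδ : 0 < δ)
    {x z : X} (hx : dist x z < δ) :
    μ.real (ball z (2 * δ)) ≤ 2 * cD ^ 3 * ∫ y, tent δ x y ∂μ := by
  have h0 : 0 ≤ cD := zero_le_one.trans h.one_le
  have h1 := h.measureReal_ball_le_of_dist (x := x) (y := z) (r := δ / 2) (s := 2 * δ)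
    (by positivity) 3 (by linarith)
  have h2 : 1 / 2 * μ.real (ball x (δ / 2)) ≤ ∫ y, tent δ x y ∂μ := by
    calc 1 / 2 * μ.real (ball x (δ / 2)) = ∫ _y in ball x (δ / 2), (1 / 2 : ℝ) ∂μ := by
          rw [setIntegral_const, smul_eq_mul, mul_comm]
      _ ≤ ∫ y in ball x (δ / 2), tent δ x y ∂μ :=
          setIntegral_mono_on (h.integrableOn_const x _ _) (h.integrable_tent hδ x).integrableOn
            measurableSet_ball fun y hy => half_le_tent hδ (mem_ball'.1 hy).le
      _ ≤ ∫ y, tent δ x y ∂μ :=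
          setIntegral_le_integral (h.integrable_tent hδ x)
            (Eventually.of_forall fun y => tent_nonneg x y)
  calc μ.real (ball z (2 * δ)) ≤ cD ^ 3 * μ.real (ball x (δ / 2)) := h1
    _ = 2 * cD ^ 3 * (1 / 2 * μ.real (ball x (δ / 2))) := by ring
    _ ≤ _ := by gcongr

theorem IsDoublingWith.integral_tent_pos (h : IsDoublingWith cD μ) (hδ : 0 < δ) (x : X) :
    0 < ∫ y, tent δ x y ∂μ := by
  have h1 := h.measureReal_ball_le_integral_tent hδ (x := x) (z := x) (by simpa)
  have h2 := h.measureReal_ball_pos x (r := 2 * δ) (by positivity)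
  have h3 : 0 < cD := zero_lt_one.trans_le h.one_le
  exact pos_of_mul_pos_right (h2.trans_le h1) (by positivity)

/-- Averaging fixes constants, so estimates may be made for $u-c$; the choice $c=u(z)$ later
produces the energy density. -/
theorem IsDoublingWith.tentAverage_sub (h : IsDoublingWith cD μ) (hδ : 0 < δ) {u : X → ℝ}
    (hu : Integrable u μ) (x : X) (c : ℝ) :
    tentAverage μ u δ x - c = (∫ y, tent δ x y * (u y - c) ∂μ) / ∫ y, tent δ x y ∂μ := by
  have hK := h.integral_tent_pos hδ x
  simp_rw [mul_sub]
  rw [integral_sub (integrable_tent_mul hδ x hu.integrableOn)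
    ((h.integrable_tent hδ x).mul_const c), integral_mul_const, tentAverage, sub_div,
    mul_div_cancel_left₀ _ hK.ne']

theorem IsDoublingWith.abs_integral_tent_mul_le (h : IsDoublingWith cD μ) (hδ : 0 < δ)
    {u : X → ℝ} (hu : Integrable u μ) {x z : X} (hx : dist x z < δ) (c : ℝ) :
    |∫ y, tent δ x y * (u y - c) ∂μ| ≤ ∫ y in ball z (2 * δ), |u y - c| ∂μ := by
  have := abs_integral_mul_le (μ := μ) (z := z) (r := 2 * δ) (a := 1) (φ := tent δ x)
    (f := fun y => u y - c) (fun y => ?_) (fun y hy => ?_)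
    (hu.integrableOn.sub (h.integrableOn_const z _ c))
  · simpa using this
  · rw [abs_of_nonneg (tent_nonneg x y)]
    exact tent_le_one hδ x y
  · refine tent_eq_zero hδ ?_
    linarith [dist_triangle z x y, dist_comm x z]

/-- Local Lipschitz estimate for tent averages. -/
theorem IsDoublingWith.abs_tentAverage_sub_le (h : IsDoublingWith cD μ) (hδ : 0 < δ)
    {u : X → ℝ} (hu : Integrable u μ) {x x' z : X} (hx : dist x z < δ) (hx' : dist x' z < δ)
    (c : ℝ) :
    |tentAverage μ u δ x - tentAverage μ u δ x'|
      ≤ (2 * cD ^ 3 + (2 * cD ^ 3) ^ 2) / δ *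
        (1 / μ.real (ball z (2 * δ)) * ∫ y in ball z (2 * δ), |u y - c| ∂μ) * dist x x' := by
  have hK := h.integral_tent_pos hδ x
  have hK' := h.integral_tent_pos hδ x'
  have hm := h.measureReal_ball_pos z (r := 2 * δ) (by positivity)
  have hA := h.measureReal_ball_le_integral_tent hδ hx
  have hA' := h.measureReal_ball_le_integral_tent hδ hx'
  have hcD : 0 < cD := zero_lt_one.trans_le h.one_le
  have hN' := h.abs_integral_tent_mul_le hδ hu hx' c
  have hzero : ∀ y, 2 * δ ≤ dist z y → tent δ x y - tent δ x' y = 0 := by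
    intro y hy
    rw [tent_eq_zero hδ (by linarith [dist_triangle z x y, dist_comm x z]),
      tent_eq_zero hδ (by linarith [dist_triangle z x' y, dist_comm x' z]), sub_zero]
  have hNd : |∫ y, tent δ x y * (u y - c) ∂μ - ∫ y, tent δ x' y * (u y - c) ∂μ|
      ≤ dist x x' / δ * ∫ y in ball z (2 * δ), |u y - c| ∂μ := by
    have hi : ∀ w : X, Integrable (fun y => tent δ w y * (u y - c)) μ := fun w =>
      integrable_tent_mul hδ w (hu.integrableOn.sub (h.integrableOn_const w _ c))
    rw [← integral_sub (hi x) (hi x')]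
    simp_rw [← sub_mul]
    exact abs_integral_mul_le (abs_tent_sub_tent_le hδ x x') hzero
      (hu.integrableOn.sub (h.integrableOn_const z _ c))
  have hKd : |∫ y, tent δ x' y ∂μ - ∫ y, tent δ x y ∂μ|
      ≤ dist x x' / δ * μ.real (ball z (2 * δ)) := by
    rw [abs_sub_comm, ← integral_sub (h.integrable_tent hδ x) (h.integrable_tent hδ x')]
    simpa using abs_integral_mul_le (f := fun _ => (1 : ℝ)) (abs_tent_sub_tent_le hδ x x') hzero
      (h.integrableOn_const z _ 1)
  have hsub : tentAverage μ u δ x - tentAverage μ u δ x'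
      = (tentAverage μ u δ x - c) - (tentAverage μ u δ x' - c) := by ring
  rw [hsub, h.tentAverage_sub hδ hu, h.tentAverage_sub hδ hu]
  have hJ0 : 0 ≤ ∫ y in ball z (2 * δ), |u y - c| ∂μ := integral_nonneg fun y => abs_nonneg _
  generalize ∫ y in ball z (2 * δ), |u y - c| ∂μ = J at *
  generalize ∫ y, tent δ x y * (u y - c) ∂μ = N at *
  generalize ∫ y, tent δ x' y * (u y - c) ∂μ = N' at *
  generalize ∫ y, tent δ x y ∂μ = K at *
  generalize ∫ y, tent δ x' y ∂μ = K' at *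
  generalize μ.real (ball z (2 * δ)) = m at *
  have hA0 : 0 < 2 * cD ^ 3 := by positivity
  generalize 2 * cD ^ 3 = A at *
  have hinv : 1 / K ≤ A / m := by rw [div_le_div_iff₀ hK hm]; linarith
  have hinv' : 1 / K' ≤ A / m := by rw [div_le_div_iff₀ hK' hm]; linarith
  -- The variation of numerator and of denominator are separated; with $1/K,1/K'\le A/m$ they
  -- contribute the summands $A$ and $A^2$ of the constant.
  calc |N / K - N' / K'| = |(N - N') * (1 / K) + N' * (K' - K) * (1 / K * (1 / K'))| := by
        congr 1
        field_simp
        ring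
    _ ≤ |N - N'| * (1 / K) + |N'| * |K' - K| * (1 / K * (1 / K')) := by
        refine (abs_add_le _ _).trans_eq ?_
        rw [abs_mul, abs_mul, abs_mul, abs_of_pos (show 0 < 1 / K by positivity),
          abs_of_pos (show 0 < 1 / K * (1 / K') by positivity)]
    _ ≤ (dist x x' / δ * J) * (A / m) + J * (dist x x' / δ * m) * (A / m * (A / m)) := by
        gcongr
    _ = _ := by
        field_simp

theorem IsDoublingWith.abs_tentAverage_sub_self_le (h : IsDoublingWith cD μ) (hδ : 0 < δ)
    {u : X → ℝ} (hu : Integrable u μ) (z : X) (c : ℝ) :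
    |tentAverage μ u δ z - c|
      ≤ 2 * cD ^ 3 * (1 / μ.real (ball z (2 * δ)) * ∫ y in ball z (2 * δ), |u y - c| ∂μ) := by
  have hz : dist z z < δ := by simpa
  have hK := h.integral_tent_pos hδ z
  have hm := h.measureReal_ball_pos z (r := 2 * δ) (by positivity)
  have hA := h.measureReal_ball_le_integral_tent hδ hz
  have hcD : 0 < cD := zero_lt_one.trans_le h.one_le
  have hN := h.abs_integral_tent_mul_le hδ hu hz c
  rw [h.tentAverage_sub hδ hu, abs_div, abs_of_pos hK]
  have hJ0 : 0 ≤ ∫ y in ball z (2 * δ), |u y - c| ∂μ := integral_nonneg fun y => abs_nonneg _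
  calc _ ≤ (∫ y in ball z (2 * δ), |u y - c| ∂μ) / ∫ y, tent δ z y ∂μ := by gcongr
    _ ≤ (∫ y in ball z (2 * δ), |u y - c| ∂μ) * (2 * cD ^ 3 / μ.real (ball z (2 * δ))) := by
        rw [div_eq_mul_one_div]
        refine mul_le_mul_of_nonneg_left ?_ hJ0
        rw [div_le_div_iff₀ hK hm]
        linarith
    _ = _ := by ring

theorem IsDoublingWith.locallyLipschitz_tentAverage (h : IsDoublingWith cD μ) (hδ : 0 < δ)
    {u : X → ℝ} (hu : Integrable u μ) : LocallyLipschitz (tentAverage μ u δ) := by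
  intro z
  refine ⟨_, ball z δ, ball_mem_nhds z hδ,
    LipschitzOnWith.of_dist_le' (K := (2 * cD ^ 3 + (2 * cD ^ 3) ^ 2) / δ *
      (1 / μ.real (ball z (2 * δ)) * ∫ y in ball z (2 * δ), |u y - 0| ∂μ))
      fun x hx y hy => ?_⟩
  rw [Real.dist_eq]
  exact h.abs_tentAverage_sub_le hδ hu hx hy 0

/-- The factor $2\delta$ undoes the $1/\varepsilon$ in the energy at scale $\varepsilon=2\delta$, so
bounded energy forces $L^1$ convergence as $\delta\to0$. -/
theorem IsDoublingWith.lintegral_tentAverage_sub_le (h : IsDoublingWith cD μ) (hδ : 0 < δ)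
    {u : X → ℝ} (hu : Integrable u μ) :
    ∫⁻ x, ENNReal.ofReal |tentAverage μ u δ x - u x| ∂μ
      ≤ ENNReal.ofReal (2 * cD ^ 3 * (2 * δ)) * ballEnergy μ u (2 * δ) := by
  have hcD : 0 < cD := zero_lt_one.trans_le h.one_le
  calc ∫⁻ x, ENNReal.ofReal |tentAverage μ u δ x - u x| ∂μ
      ≤ ∫⁻ x, ENNReal.ofReal (2 * cD ^ 3) * ((μ (ball x (2 * δ)))⁻¹ *
          ∫⁻ y in ball x (2 * δ), ENNReal.ofReal |u x - u y| ∂μ) ∂μ := by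
        refine lintegral_mono fun x => ?_
        rw [← h.ofReal_mean_eq hδ hu x, ← ENNReal.ofReal_mul (by positivity)]
        exact ENNReal.ofReal_le_ofReal (h.abs_tentAverage_sub_self_le hδ hu x (u x))
    _ = _ := by
        rw [lintegral_const_mul' _ _ ENNReal.ofReal_ne_top, ballEnergy, ← mul_assoc,
          ← ENNReal.ofReal_mul (by positivity)]
        congr 2
        field_simp

variable [SecondCountableTopology X] [SFinite μ]

/-- The Lipschitz estimate around $z$ with $c=u(z)$ has as its slope the energy density of $u$ at
scale $2\delta$, up to a constant; this slope is an upper gradient. -/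
theorem IsDoublingWith.gradientEnergy_tentAverage_le (h : IsDoublingWith cD μ) (hδ : 0 < δ)
    {u : X → ℝ} (hum : Measurable u) (hu : Integrable u μ) :
    gradientEnergy μ (tentAverage μ u δ)
      ≤ ENNReal.ofReal (2 * (2 * cD ^ 3 + (2 * cD ^ 3) ^ 2)) * ballEnergy μ u (2 * δ) := by
  have hcD : 0 < cD := zero_lt_one.trans_le h.one_le
  set G : X → ℝ≥0∞ := fun z => ENNReal.ofReal ((2 * cD ^ 3 + (2 * cD ^ 3) ^ 2) / δ) *
    ((μ (ball z (2 * δ)))⁻¹ * ∫⁻ y in ball z (2 * δ), ENNReal.ofReal |u z - u y| ∂μ) with hG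
  have hGm : Measurable G := ((measurable_measure_ball _).inv.mul
    (measurable_setLIntegral_ball (measurable_ofReal_abs_sub hum) _)).const_mul _
  have hGu : IsWeakUpperGradient μ (tentAverage μ u δ) G := by
    refine isWeakUpperGradient_of_forall hGm fun γ => γ.ofReal_abs_sub_le hδ fun z x y hx hy => ?_
    rw [hG]
    dsimp only
    rw [← h.ofReal_mean_eq hδ hu z, ← ENNReal.ofReal_mul (by positivity),
      ← ENNReal.ofReal_mul (by positivity)]
    exact ENNReal.ofReal_le_ofReal (h.abs_tentAverage_sub_le hδ hu hx hy (u z))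
  refine (iInf₂_le G hGu).trans_eq ?_
  rw [hG, lintegral_const_mul' _ _ ENNReal.ofReal_ne_top, ballEnergy, ← mul_assoc,
    ← ENNReal.ofReal_mul (by positivity)]
  congr 2
  field_simp

theorem IsDoublingWith.totalVariation_lt_top (h : IsDoublingWith cD μ) {u : X → ℝ}
    (hum : Measurable u) (hu : Integrable u μ)
    (hE : liminf (fun ε : ℝ => nearDiagonalEnergy μ u ε) (𝓝[>] 0) < ∞) :
    totalVariation μ u < ∞ := by
  obtain ⟨c, hEc, hc⟩ := exists_between hE
  have hfreq : ∃ᶠ ε in 𝓝[>] (0 : ℝ), nearDiagonalEnergy μ u ε < c ∧ 0 < ε :=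
    (frequently_lt_of_liminf_lt (by isBoundedDefault) hEc).and_eventually self_mem_nhdsWithin
  obtain ⟨ε, hεlim, hε⟩ := exists_seq_forall_of_frequently hfreq
  have hε0 : Tendsto ε atTop (𝓝 0) := hεlim.mono_right nhdsWithin_le_nhds
  -- Tents of radius $\varepsilon_j/2$ see balls of radius exactly $\varepsilon_j$, the scale at
  -- which the energy is controlled.
  have hball : ∀ j, ballEnergy μ u (2 * (ε j / 2)) ≤ ENNReal.ofReal cD * c := fun j => by
    rw [mul_div_cancel₀ _ two_ne_zero]
    exact (h.ballEnergy_le_nearDiagonalEnergy hum _).trans (by gcongr; exact (hε j).1.le)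
  have hpos : ∀ j, 0 < ε j / 2 := fun j => half_pos (hε j).2
  have hconv : TendstoL1Loc μ (fun j => tentAverage μ u (ε j / 2)) u := by
    intro x r _
    have hlim : Tendsto (fun j => ENNReal.ofReal (2 * cD ^ 3 * (2 * (ε j / 2))) *
        (ENNReal.ofReal cD * c)) atTop (𝓝 0) := by
      have h1 : Tendsto (fun j => 2 * cD ^ 3 * (2 * (ε j / 2))) atTop (𝓝 0) := by
        simpa [mul_div_cancel₀] using hε0.const_mul (2 * cD ^ 3)
      have h2 := ENNReal.tendsto_ofReal h1
      rw [ENNReal.ofReal_zero] at h2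
      simpa using ENNReal.Tendsto.mul_const (b := ENNReal.ofReal cD * c) h2
        (Or.inr (ENNReal.mul_ne_top ENNReal.ofReal_ne_top hc.ne))
    refine tendsto_of_tendsto_of_tendsto_of_le_of_le tendsto_const_nhds hlim
      (fun j => zero_le) fun j => ?_
    exact (setLIntegral_le_lintegral _ _).trans
      ((h.lintegral_tentAverage_sub_le (hpos j) hu).trans (by gcongr; exact hball j))
  have hle : totalVariation μ u ≤ ENNReal.ofReal (2 * (2 * cD ^ 3 + (2 * cD ^ 3) ^ 2)) *
      (ENNReal.ofReal cD * c) := by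
    refine (iInf₂_le _ fun j => h.locallyLipschitz_tentAverage (hpos j) hu).trans
      ((iInf_le _ hconv).trans ?_)
    refine liminf_le_of_le (by isBoundedDefault) fun b hb => ?_
    obtain ⟨j, hj⟩ := hb.exists
    exact hj.trans ((h.gradientEnergy_tentAverage_le (hpos j) hum hu).trans
      (by gcongr; exact hball j))
  refine hle.trans_lt ?_
  have := hc.ne
  exact (by finiteness : _ ≠ ∞).lt_top

end KernelAverage

end NearDiagonal

/-! ### Lipschitz approximation of lower semicontinuous functions from below -/

namespace NearDiagonal

section LipschitzApproximation

variable {X : Type*} [MetricSpace X]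

/-- The largest `n`-Lipschitz function below `min h n`. -/
noncomputable def lipApprox (h : X → ℝ≥0∞) (n : ℕ) (x : X) : ℝ≥0∞ :=
  ⨅ y, (min (h y) n + n * edist x y)

theorem lipApprox_le (h : X → ℝ≥0∞) (n : ℕ) (x : X) : lipApprox h n x ≤ min (h x) n :=
  (iInf_le _ x).trans_eq (by simp)

theorem lipApprox_ne_top (h : X → ℝ≥0∞) (n : ℕ) (x : X) : lipApprox h n x ≠ ∞ :=
  ne_top_of_le_ne_top (ENNReal.natCast_ne_top n) ((lipApprox_le h n x).trans (min_le_right _ _))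

theorem lipApprox_mono (h : X → ℝ≥0∞) (x : X) : Monotone fun n => lipApprox h n x := by
  intro m n hmn
  refine iInf_mono fun y => ?_
  have : (m : ℝ≥0∞) ≤ n := by exact_mod_cast hmn
  gcongr

theorem lipApprox_le_add (h : X → ℝ≥0∞) (n : ℕ) (x x' : X) :
    lipApprox h n x ≤ lipApprox h n x' + n * edist x x' := by
  rw [lipApprox, lipApprox, ENNReal.iInf_add]
  refine iInf_mono fun y => ?_
  rw [add_assoc, ← mul_add, add_comm (edist x' y)]
  gcongr
  exact edist_triangle x x' y

theorem continuous_toReal_lipApprox (h : X → ℝ≥0∞) (n : ℕ) :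
    Continuous fun x => (lipApprox h n x).toReal := by
  refine (LipschitzWith.of_le_add_mul (n : ℝ≥0) fun x y => ?_).continuous
  have := ENNReal.toReal_mono (by finiteness [lipApprox_ne_top h n y, edist_ne_top x y])
    (lipApprox_le_add h n x y)
  rwa [ENNReal.toReal_add (lipApprox_ne_top h n y) (by finiteness [edist_ne_top x y]),
    ENNReal.toReal_mul, ENNReal.toReal_natCast, edist_dist,
    ENNReal.toReal_ofReal dist_nonneg] at this

/-- For $c'<h(x)$, points $y$ near $x$ have $h(y)>c'$ by semicontinuity, and at far points the
penalty $n\,d(x,y)$ alone exceeds $c'$. -/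
theorem le_iSup_lipApprox {h : X → ℝ≥0∞} (hh : LowerSemicontinuous h) (x : X) :
    h x ≤ ⨆ n, lipApprox h n x := by
  refine le_of_forall_lt fun c hc => ?_
  obtain ⟨c', hcc', hc'⟩ := exists_between hc
  refine hcc'.trans_le ?_
  have hc't : c' ≠ ∞ := (hc'.trans_le le_top).ne
  obtain ⟨δ, hδ, hball⟩ := Metric.nhds_basis_eball.eventually_iff.1 (hh x c' hc')
  obtain ⟨n, hn⟩ := ENNReal.exists_nat_mul_gt hδ.ne' hc't
  obtain ⟨m, hm⟩ := ENNReal.exists_nat_gt hc't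
  -- Here `n` makes the penalty large enough and `m` makes the truncation level exceed $c'$.
  refine le_trans (le_iInf fun y => ?_) (le_iSup (fun n => lipApprox h n x) (max n m))
  have h1 : (n : ℝ≥0∞) ≤ (max n m : ℕ) := by exact_mod_cast le_max_left n m
  have h2 : (m : ℝ≥0∞) ≤ (max n m : ℕ) := by exact_mod_cast le_max_right n m
  rcases lt_or_ge (edist y x) δ with hy | hy
  · exact le_add_right (le_min (hball hy).le (hm.le.trans h2))
  · rw [edist_comm]
    exact le_add_left (hn.le.trans (by gcongr))

end LipschitzApproximation

/-! ### Discrete chains, their minimal cost, and step curves -/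

section Chains

variable {X : Type*} [MetricSpace X]

/-- The length of the first `i` steps of the chain `x`. -/
noncomputable def chainLength (x : ℕ → X) (i : ℕ) : ℝ :=
  ∑ k ∈ Finset.range i, dist (x k) (x (k + 1))

/-- The cost of the first `N` steps of the chain `x` for the weight `g`. -/
noncomputable def chainCost (g : X → ℝ) (x : ℕ → X) (N : ℕ) : ℝ :=
  ∑ k ∈ Finset.range N, g (x k) * dist (x k) (x (k + 1))

/-- The infimum of `v (x 0) + chainCost g x N` over all chains `x 0, …, x N = y` with steps of
length at most `s`. -/
noncomputable def chainInf (v g : X → ℝ) (s : ℝ) (y : X) : ℝ :=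
  sInf {a | ∃ (x : ℕ → X) (N : ℕ), x N = y ∧ (∀ i < N, dist (x i) (x (i + 1)) ≤ s) ∧
    a = v (x 0) + chainCost g x N}

variable {v g : X → ℝ} {s : ℝ}

theorem chainCost_nonneg (hg : ∀ x, 0 ≤ g x) (x : ℕ → X) (N : ℕ) : 0 ≤ chainCost g x N :=
  Finset.sum_nonneg fun _ _ => mul_nonneg (hg _) dist_nonneg

theorem bddBelow_chainInf (hv : ∀ x, 0 ≤ v x) (hg : ∀ x, 0 ≤ g x) (y : X) :
    BddBelow {a | ∃ (x : ℕ → X) (N : ℕ), x N = y ∧ (∀ i < N, dist (x i) (x (i + 1)) ≤ s) ∧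
      a = v (x 0) + chainCost g x N} := by
  refine ⟨0, ?_⟩
  rintro _ ⟨x, N, -, -, rfl⟩
  exact add_nonneg (hv _) (chainCost_nonneg hg x N)

theorem nonempty_chainInf (v g : X → ℝ) (s : ℝ) (y : X) :
    {a | ∃ (x : ℕ → X) (N : ℕ), x N = y ∧ (∀ i < N, dist (x i) (x (i + 1)) ≤ s) ∧
      a = v (x 0) + chainCost g x N}.Nonempty :=
  ⟨_, fun _ => y, 0, rfl, by simp, rfl⟩

theorem chainInf_nonneg (hv : ∀ x, 0 ≤ v x) (hg : ∀ x, 0 ≤ g x) (y : X) :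
    0 ≤ chainInf v g s y := by
  refine le_csInf (nonempty_chainInf v g s y) ?_
  rintro _ ⟨x, N, -, -, rfl⟩
  exact add_nonneg (hv _) (chainCost_nonneg hg x N)

theorem chainInf_le (hv : ∀ x, 0 ≤ v x) (hg : ∀ x, 0 ≤ g x) (y : X) :
    chainInf v g s y ≤ v y :=
  csInf_le (bddBelow_chainInf hv hg y) ⟨fun _ => y, 0, rfl, by simp, by simp [chainCost]⟩

theorem exists_chain_of_chainInf_lt {y : X} {c : ℝ} (h : chainInf v g s y < c) :
    ∃ (x : ℕ → X) (N : ℕ), x N = y ∧ (∀ i < N, dist (x i) (x (i + 1)) ≤ s) ∧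
      v (x 0) + chainCost g x N < c := by
  obtain ⟨_, ⟨x, N, hN, hs, rfl⟩, hlt⟩ := exists_lt_of_csInf_lt (nonempty_chainInf v g s y) h
  exact ⟨x, N, hN, hs, hlt⟩

theorem chainInf_le_add (hv : ∀ x, 0 ≤ v x) (hg : ∀ x, 0 ≤ g x) {y z : X} (hyz : dist y z ≤ s) :
    chainInf v g s z ≤ chainInf v g s y + g y * dist y z := by
  rw [← sub_le_iff_le_add]
  refine le_csInf (nonempty_chainInf v g s y) ?_
  rintro _ ⟨x, N, hN, hs, rfl⟩
  rw [sub_le_iff_le_add]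
  -- A chain ending at `y` is prolonged by the point `z`; the new last step costs $g(y)\,d(y,z)$.
  have hx : ∀ i ≤ N, Function.update x (N + 1) z i = x i := fun i hi =>
    Function.update_of_ne (by omega) _ _
  refine csInf_le (bddBelow_chainInf hv hg z)
    ⟨Function.update x (N + 1) z, N + 1, Function.update_self _ _ _, fun i hi => ?_, ?_⟩
  · rcases Nat.lt_succ_iff_lt_or_eq.1 hi with hi' | rfl
    · rw [hx i hi'.le, hx (i + 1) hi']
      exact hs i hi'
    · rw [hx i le_rfl, Function.update_self, hN]
      exact hyz
  · rw [hx 0 (Nat.zero_le _), add_assoc]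
    simp only [chainCost]
    rw [Finset.sum_range_succ, hx N le_rfl, Function.update_self, hN]
    congr 2
    refine Finset.sum_congr rfl fun i hi => ?_
    rw [Finset.mem_range] at hi
    rw [hx i hi.le, hx (i + 1) hi]

theorem abs_chainInf_sub_le (hv : ∀ x, 0 ≤ v x) (hg : ∀ x, 0 ≤ g x) {y z : X}
    (hyz : dist y z ≤ s) :
    |chainInf v g s y - chainInf v g s z| ≤ max (g y) (g z) * dist y z := by
  have h1 := chainInf_le_add hv hg hyz
  have h2 := chainInf_le_add hv hg (y := z) (z := y) (s := s) (by rwa [dist_comm])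
  rw [dist_comm z y] at h2
  have h3 := mul_le_mul_of_nonneg_right (le_max_left (g y) (g z)) (dist_nonneg (x := y) (y := z))
  have h4 := mul_le_mul_of_nonneg_right (le_max_right (g y) (g z)) (dist_nonneg (x := y) (y := z))
  rw [abs_le]
  constructor <;> linarith

/-- Up to distance $s$ the slope is at most $K$; beyond $s$ the oscillation $M$ is at most
$(M/s)\,d(y,z)$. Boundedness of $v$ thus makes the function globally Lipschitz, as the Poincaré
hypothesis requires. -/
theorem exists_lipschitzWith_chainInf {M K : ℝ} (hv : ∀ x, 0 ≤ v x) (hvM : ∀ x, v x ≤ M)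
    (hg : ∀ x, 0 ≤ g x) (hgK : ∀ x, g x ≤ K) (hs : 0 < s) :
    ∃ C : ℝ≥0, LipschitzWith C (chainInf v g s) := by
  refine ⟨Real.toNNReal (max K (M / s)), LipschitzWith.of_dist_le' fun y z => ?_⟩
  rw [Real.dist_eq]
  rcases le_or_gt (dist y z) s with h | h
  · refine (abs_chainInf_sub_le hv hg h).trans ?_
    exact mul_le_mul_of_nonneg_right ((max_le (hgK y) (hgK z)).trans (le_max_left _ _))
      dist_nonneg
  · have hM : 0 ≤ M := (hv y).trans (hvM y)
    have h1 := chainInf_nonneg (s := s) hv hg y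
    have h2 := chainInf_nonneg (s := s) hv hg z
    have h3 := (chainInf_le (s := s) hv hg y).trans (hvM y)
    have h4 := (chainInf_le (s := s) hv hg z).trans (hvM z)
    calc |chainInf v g s y - chainInf v g s z| ≤ M := by rw [abs_le]; constructor <;> linarith
      _ = M / s * s := by field_simp
      _ ≤ max K (M / s) * dist y z := by
        gcongr
        exact le_max_right _ _

/-- By continuity of $g$, the maximum of $g(y)$ and $g(z)$ tends to $g(y)$ as $z\to y$. -/
theorem lip_le_of_abs_sub_le {f : X → ℝ} (hg : Continuous g) (hs : 0 < s)
    (hf : ∀ y z, dist y z ≤ s → |f y - f z| ≤ max (g y) (g z) * dist y z) (y : X) :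
    lip f y ≤ ENNReal.ofReal (g y) := by
  refine ENNReal.le_of_forall_pos_le_add fun a ha _ => ?_
  have ha' : (0 : ℝ) < a := ha
  have hnear : ∀ᶠ z in 𝓝 y, g z < g y + a := hg.continuousAt.eventually_lt
    continuousAt_const (by linarith)
  obtain ⟨δ, hδ, hball⟩ := Metric.eventually_nhds_iff_ball.1 hnear
  refine liminf_le_of_le (by isBoundedDefault) fun b hb => ?_
  have hsmall : ∀ᶠ ρ in 𝓝[>] (0 : ℝ), ρ < min δ s :=
    eventually_nhdsWithin_of_eventually_nhds (eventually_lt_nhds (lt_min hδ hs))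
  obtain ⟨ρ, hbρ, hρ⟩ := (hb.and hsmall).exists
  refine hbρ.trans (iSup₂_le fun z hz => ?_)
  rw [mem_ball] at hz
  have hza := hball z (mem_ball.2 (hz.trans (hρ.trans_le (min_le_left _ _))))
  have hfz := hf y z (by rw [dist_comm]; exact (hz.trans (hρ.trans_le (min_le_right _ _))).le)
  have hmax : max (g y) (g z) ≤ g y + a := max_le (by linarith) hza.le
  calc ENNReal.ofReal (|f y - f z| / dist y z) ≤ ENNReal.ofReal (max (g y) (g z)) := by
        rcases (dist_nonneg (x := y) (y := z)).eq_or_lt with h0 | h0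
        · simp [← h0]
        · exact ENNReal.ofReal_le_ofReal ((div_le_iff₀ h0).2 hfz)
    _ ≤ ENNReal.ofReal (g y + a) := ENNReal.ofReal_le_ofReal hmax
    _ ≤ ENNReal.ofReal (g y) + a := by
        refine ENNReal.ofReal_add_le.trans ?_
        rw [ENNReal.ofReal_coe_nnreal]

theorem chainLength_mono (x : ℕ → X) : Monotone (chainLength x) :=
  monotone_nat_of_le_succ fun n => by
    rw [chainLength, chainLength, Finset.sum_range_succ]
    exact le_add_of_nonneg_right dist_nonneg

theorem chainLength_nonneg (x : ℕ → X) (n : ℕ) : 0 ≤ chainLength x n :=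
  Finset.sum_nonneg fun _ _ => dist_nonneg

theorem dist_le_chainLength_sub (x : ℕ → X) {i j : ℕ} (hij : i ≤ j) :
    dist (x i) (x j) ≤ chainLength x j - chainLength x i := by
  rw [chainLength, chainLength, ← Finset.sum_Ico_eq_sub _ hij]
  exact dist_le_Ico_sum_dist x hij

/-- A positive lower bound on the weight turns bounded cost into bounded length, hence into
compactness. -/
theorem mul_chainLength_le {η : ℝ} (hg : ∀ x, η ≤ g x) (x : ℕ → X) (N : ℕ) :
    η * chainLength x N ≤ chainCost g x N := by
  rw [chainLength, chainCost, Finset.mul_sum]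
  exact Finset.sum_le_sum fun i _ => mul_le_mul_of_nonneg_right (hg _) dist_nonneg

open scoped Classical in
/-- The index of the last point that the chain has reached at time `t`. -/
noncomputable def chainIndex (x : ℕ → X) (N : ℕ) (t : ℝ) : ℕ :=
  Nat.findGreatest (fun i => chainLength x i ≤ t) N

/-- The step curve that runs through the points `x 0, …, x N` with unit speed. -/
noncomputable def stepCurve (x : ℕ → X) (N : ℕ) (t : ℝ) : X := x (chainIndex x N t)

theorem chainIndex_le (x : ℕ → X) (N : ℕ) (t : ℝ) : chainIndex x N t ≤ N :=
  Nat.findGreatest_le N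

theorem chainIndex_mono (x : ℕ → X) (N : ℕ) : Monotone (chainIndex x N) := fun _ _ hst =>
  Nat.findGreatest_mono_left (fun _ hi => hi.trans hst) N

theorem chainLength_chainIndex_le (x : ℕ → X) (N : ℕ) {t : ℝ} (ht : 0 ≤ t) :
    chainLength x (chainIndex x N t) ≤ t := by
  classical
  exact Nat.findGreatest_spec (P := fun i => chainLength x i ≤ t) (Nat.zero_le N)
    (by simpa [chainLength] using ht)

theorem lt_chainLength_of_chainIndex_lt (x : ℕ → X) {N k : ℕ} {t : ℝ}
    (hk : chainIndex x N t < k) (hkN : k ≤ N) : t < chainLength x k := by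
  classical
  exact not_le.1 (Nat.findGreatest_is_greatest (P := fun i => chainLength x i ≤ t) hk hkN)

theorem chainIndex_eq (x : ℕ → X) {N i : ℕ} (hi : i < N) {t : ℝ}
    (h1 : chainLength x i ≤ t) (h2 : t < chainLength x (i + 1)) : chainIndex x N t = i := by
  classical
  refine le_antisymm ?_ (Nat.le_findGreatest (P := fun i => chainLength x i ≤ t) hi.le h1)
  by_contra! hlt
  have h3 := chainLength_mono x (Nat.succ_le_of_lt hlt)
  have h4 := chainLength_chainIndex_le x N ((chainLength_nonneg x i).trans h1)
  simp only [Nat.succ_eq_add_one] at h3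
  linarith

theorem stepCurve_eq_of_chainLength_le (x : ℕ → X) {N : ℕ} {t : ℝ} (h : chainLength x N ≤ t) :
    stepCurve x N t = x N := by
  classical
  rw [stepCurve, show chainIndex x N t = N from le_antisymm (chainIndex_le x N t)
    (Nat.le_findGreatest (P := fun i => chainLength x i ≤ t) le_rfl h)]

theorem stepCurve_zero (x : ℕ → X) (N : ℕ) : stepCurve x N 0 = x 0 := by
  have h1 := chainLength_chainIndex_le x N le_rfl
  have h2 := dist_le_chainLength_sub x (Nat.zero_le (chainIndex x N 0))
  have h3 := chainLength_nonneg x 0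
  rw [stepCurve]
  exact (dist_le_zero.1 (by linarith)).symm

/-- At time $a$ the curve is less than one step behind: $a<\ell_{i}+s$ for the current index $i$,
while $\ell_j\le b$ for the index $j$ at time $b$. The defect $s$ vanishes in the limit, leaving a
1-Lipschitz curve. -/
theorem dist_stepCurve_le_of_le (x : ℕ → X) {N : ℕ}
    (hs : ∀ i < N, dist (x i) (x (i + 1)) ≤ s) (hs0 : 0 ≤ s) {a b : ℝ} (hab : a ≤ b) :
    dist (stepCurve x N a) (stepCurve x N b) ≤ b - a + s := by
  rcases (chainIndex_mono x N hab).eq_or_lt with he | hlt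
  · rw [stepCurve, stepCurve, he, dist_self]
    linarith
  -- At negative times `Nat.findGreatest` returns its default 0, whereas the index at `b` is
  -- positive here.
  have hb : 0 ≤ b := by
    by_contra! hb
    have h0 := chainLength_nonneg x (chainIndex x N b)
    classical
    have := Nat.findGreatest_of_ne_zero (P := fun i => chainLength x i ≤ b) (n := N)
      (m := chainIndex x N b) rfl (by omega)
    linarith
  have hN : chainIndex x N a < N := hlt.trans_le (chainIndex_le x N b)
  have h1 := dist_le_chainLength_sub x hlt.le
  have h2 := chainLength_chainIndex_le x N hb
  have h3 := lt_chainLength_of_chainIndex_lt x (Nat.lt_succ_self _) hN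
  have h4 := hs _ hN
  rw [Nat.succ_eq_add_one, chainLength, Finset.sum_range_succ, ← chainLength] at h3
  rw [stepCurve, stepCurve]
  linarith

theorem dist_stepCurve_le (x : ℕ → X) {N : ℕ} (hs : ∀ i < N, dist (x i) (x (i + 1)) ≤ s)
    (hs0 : 0 ≤ s) (a b : ℝ) : dist (stepCurve x N a) (stepCurve x N b) ≤ |b - a| + s := by
  rcases le_total a b with h | h
  · rw [abs_of_nonneg (sub_nonneg.2 h)]
    exact dist_stepCurve_le_of_le x hs hs0 h
  · rw [dist_comm, abs_sub_comm, abs_of_nonneg (sub_nonneg.2 h)]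
    exact dist_stepCurve_le_of_le x hs hs0 h

theorem dist_stepCurve_end_le (x : ℕ → X) (N : ℕ) (t : ℝ) :
    dist (stepCurve x N t) (x N) ≤ chainLength x N := by
  have := dist_le_chainLength_sub x (chainIndex_le x N t)
  have := chainLength_nonneg x (chainIndex x N t)
  rw [stepCurve]
  linarith

theorem measurable_stepCurve [MeasurableSpace X] (x : ℕ → X) (N : ℕ) :
    Measurable (stepCurve x N) :=
  (measurable_from_nat (f := x)).comp (chainIndex_mono x N).measurable

/-- On $[\ell_m,\ell_{m+1})$ the step curve rests at $x_m$, so each step contributes exactly its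
cost; steps of length zero give empty intervals. -/
theorem lintegral_stepCurve_le (hg : ∀ x, 0 ≤ g x) (x : ℕ → X) (N : ℕ) :
    ∫⁻ t in Ico 0 (chainLength x N), ENNReal.ofReal (g (stepCurve x N t))
      ≤ ENNReal.ofReal (chainCost g x N) := by
  suffices ∀ m ≤ N, ∫⁻ t in Ico 0 (chainLength x m), ENNReal.ofReal (g (stepCurve x N t))
      ≤ ENNReal.ofReal (chainCost g x m) from this N le_rfl
  intro m
  induction m with
  | zero => simp [chainLength]
  | succ m ih =>
    intro hm
    rw [← Ico_union_Ico_eq_Ico (chainLength_nonneg x m) (chainLength_mono x (Nat.le_succ m)),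
      lintegral_union measurableSet_Ico (Ico_disjoint_Ico_same ..), chainCost,
      Finset.sum_range_succ, ← chainCost, ENNReal.ofReal_add (chainCost_nonneg hg x m)
      (mul_nonneg (hg _) dist_nonneg)]
    refine add_le_add (ih (Nat.le_of_succ_le hm)) ?_
    calc ∫⁻ t in Ico (chainLength x m) (chainLength x (m + 1)),
          ENNReal.ofReal (g (stepCurve x N t))
        = ∫⁻ _t in Ico (chainLength x m) (chainLength x (m + 1)), ENNReal.ofReal (g (x m)) := by
          refine setLIntegral_congr_fun measurableSet_Ico fun t ht => ?_
          simp only [stepCurve, chainIndex_eq x hm ht.1 ht.2]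
      _ = ENNReal.ofReal (g (x m) * dist (x m) (x (m + 1))) := by
          rw [setLIntegral_const, Real.volume_Ico, ← ENNReal.ofReal_mul (hg _)]
          congr 2
          rw [chainLength, chainLength, Finset.sum_range_succ]
          ring
      _ ≤ _ := le_rfl

end Chains

end NearDiagonal

/-! ### Arc length reparametrization of Lipschitz curves -/

namespace NearDiagonal

section ArcLength

/-- A 1-Lipschitz map does not increase one-dimensional Hausdorff measure, which on the line is
Lebesgue measure. For the arc length function this replaces a change of variables and avoids
derivatives. -/
theorem restrict_le_map_of_lipschitzOnWith {σ : ℝ → ℝ} {S T : Set ℝ} (hS : MeasurableSet S)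
    (hσ : LipschitzOnWith 1 σ S) (hTS : T ⊆ σ '' S) :
    volume.restrict T ≤ (volume.restrict S).map σ := by
  refine Measure.le_iff.2 fun A hA => ?_
  have hm : AEMeasurable σ (volume.restrict S) := hσ.continuousOn.aemeasurable hS
  rw [Measure.map_apply_of_aemeasurable hm hA, Measure.restrict_apply hA]
  refine le_trans ?_ (Measure.le_restrict_apply _ _)
  have hsub : A ∩ T ⊆ σ '' (σ ⁻¹' A ∩ S) := by
    rintro _ ⟨hrA, hrT⟩
    obtain ⟨t, ht, rfl⟩ := hTS hrT
    exact ⟨t, ⟨hrA, ht⟩, rfl⟩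
  refine (measure_mono hsub).trans ?_
  have := (hσ.mono (inter_subset_right (s := σ ⁻¹' A))).hausdorffMeasure_image_le
    (d := 1) zero_le_one
  simpa [hausdorffMeasure_real] using this

variable {X : Type*} [MetricSpace X]

/-- The upper gradient inequality extends to curves that are parametrized as `1`-Lipschitz maps. -/
theorem ofReal_abs_sub_le_of_lipschitzWith {v : X → ℝ} {h : X → ℝ≥0∞}
    (hv : ∀ γ : RectifiableCurve X,
      ENNReal.ofReal |v (γ.toFun 0) - v (γ.toFun γ.length)| ≤ γ.integral h)
    {c : ℝ → X} (hc : LipschitzWith 1 c) {L : ℝ} (hL : 0 ≤ L) :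
    ENNReal.ofReal |v (c 0) - v (c L)| ≤ ∫⁻ t in Icc 0 L, h (c t) := by
  have hbv : LocallyBoundedVariationOn c (Icc 0 L) := hc.locallyBoundedVariationOn _
  have h0 : (0 : ℝ) ∈ Icc 0 L := ⟨le_rfl, hL⟩
  have hL' : L ∈ Icc 0 L := ⟨hL, le_rfl⟩
  set σ := variationOnFromTo c (Icc 0 L) 0 with hσdef
  have hmono : MonotoneOn σ (Icc 0 L) := variationOnFromTo.monotoneOn hbv h0
  have hσ0 : σ 0 = 0 := variationOnFromTo.self c (Icc 0 L) 0
  have hle : ∀ a ∈ Icc 0 L, ∀ b ∈ Icc 0 L, a ≤ b → σ b - σ a ≤ b - a := by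
    intro a ha b hb hab
    have h1 := variationOnFromTo.add hbv h0 ha hb
    have h2 : eVariationOn c (Icc 0 L ∩ Icc a b) ≤ ENNReal.ofReal (b - a) := by
      have h3 := (hc.lipschitzOnWith (s := univ)).comp_eVariationOn_le (g := id)
        (s := Icc 0 L ∩ Icc a b) (mapsTo_univ _ _)
      rw [Function.comp_id, ENNReal.coe_one, one_mul] at h3
      exact h3.trans ((monotone_id.monotoneOn _).eVariationOn_eq ha hb).le
    rw [variationOnFromTo.eq_of_le c _ hab] at h1
    have h4 := ENNReal.toReal_mono ENNReal.ofReal_ne_top h2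
    rw [ENNReal.toReal_ofReal (sub_nonneg.2 hab)] at h4
    rw [hσdef]
    linarith
  have hlip : LipschitzOnWith 1 σ (Icc 0 L) := by
    refine LipschitzOnWith.of_dist_le_mul fun a ha b hb => ?_
    rw [NNReal.coe_one, one_mul, Real.dist_eq, Real.dist_eq]
    rcases le_total a b with hab | hab
    · rw [abs_sub_comm, abs_sub_comm a b, abs_of_nonneg (sub_nonneg.2 (hmono ha hb hab)),
        abs_of_nonneg (sub_nonneg.2 hab)]
      exact hle a ha b hb hab
    · rw [abs_of_nonneg (sub_nonneg.2 (hmono hb ha hab)), abs_of_nonneg (sub_nonneg.2 hab)]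
      exact hle b hb a ha hab
  have himg : σ '' Icc 0 L = Icc 0 (σ L) := by
    refine Subset.antisymm ?_ ?_
    · rintro _ ⟨t, ht, rfl⟩
      exact ⟨hσ0 ▸ hmono h0 ht ht.1, hmono ht hL' ht.2⟩
    · have := intermediate_value_Icc hL hlip.continuousOn
      rwa [hσ0] at this
  have hnat : ∀ t ∈ Icc 0 L, naturalParameterization c (Icc 0 L) 0 (σ t) = c t := fun t ht =>
    edist_eq_zero.1 (edist_naturalParameterization_eq_zero hbv h0 ht)
  -- A curve of length zero is no `RectifiableCurve`, but its end points coincide.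
  rcases (hσ0 ▸ hmono h0 hL' hL : 0 ≤ σ L).eq_or_lt with hℓ | hℓ
  · have : c 0 = c L := by rw [← hnat 0 h0, ← hnat L hL', hσ0, ← hℓ]
    simp [this]
  set γ : RectifiableCurve X :=
    { length := σ L
      length_pos := hℓ
      toFun := naturalParameterization c (Icc 0 L) 0
      unitSpeed := himg ▸ has_unit_speed_naturalParameterization c hbv h0 } with hγ
  have hγ0 : γ.toFun 0 = c 0 := by rw [← hnat 0 h0, hσ0]
  have hγL : γ.toFun γ.length = c L := hnat L hL'
  have hint := hv γ
  rw [hγ0, hγL] at hint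
  refine hint.trans ?_
  calc γ.integral h = ∫⁻ r in Icc 0 (σ L), h (γ.toFun r) := rfl
    _ ≤ ∫⁻ r, h (γ.toFun r) ∂((volume.restrict (Icc 0 L)).map σ) :=
        lintegral_mono' (restrict_le_map_of_lipschitzOnWith measurableSet_Icc
          hlip himg.ge) le_rfl
    _ ≤ ∫⁻ t in Icc 0 L, h (γ.toFun (σ t)) := lintegral_map_le _ _
    _ = ∫⁻ t in Icc 0 L, h (c t) :=
        setLIntegral_congr_fun measurableSet_Icc fun t ht => congrArg h (hnat t ht)

end ArcLength

/-! ### Limits of chains -/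

section Limits

variable {X : Type*} [MetricSpace X]

/-- Chains with vanishing steps, bounded lengths and a common end point subconverge to a curve. -/
theorem exists_limit_curve [ProperSpace X] {x : ℕ → ℕ → X} {N : ℕ → ℕ} {s : ℕ → ℝ}
    (hs : ∀ n, ∀ i < N n, dist (x n i) (x n (i + 1)) ≤ s n) (hs0 : ∀ n, 0 ≤ s n)
    (hslim : Tendsto s atTop (𝓝 0)) {y : X} (hy : ∀ n, x n (N n) = y) {R : ℝ}
    (hR : ∀ n, chainLength (x n) (N n) ≤ R) :
    ∃ φ : ℕ → ℕ, StrictMono φ ∧ ∃ (L : ℝ) (c : ℝ → X), 0 ≤ L ∧ LipschitzWith 1 c ∧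
      Tendsto (fun n => chainLength (x (φ n)) (N (φ n))) atTop (𝓝 L) ∧
      ∀ t, Tendsto (fun n => stepCurve (x (φ n)) (N (φ n)) t) atTop (𝓝 (c t)) := by
  -- All step curves end at `y`, so their values stay in a fixed compact ball. The countable product
  -- over rational times, with the lengths as an extra coordinate, gives one common subsequence.
  have hcomp : IsCompact ((Icc 0 R) ×ˢ (univ.pi fun _ : ℚ => closedBall y R)) :=
    isCompact_Icc.prod (isCompact_univ_pi fun _ => isCompact_closedBall y R)
  obtain ⟨⟨L, q⟩, hLq, φ, hφ, hlim⟩ := hcomp.tendsto_subseq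
    (x := fun n => (chainLength (x n) (N n), fun r : ℚ => stepCurve (x n) (N n) (r : ℝ)))
    (fun n => ⟨⟨chainLength_nonneg _ _, hR n⟩, fun r _ => by
      have := dist_stepCurve_end_le (x n) (N n) (r : ℝ)
      rw [hy n] at this
      exact this.trans (hR n)⟩)
  have hlimL : Tendsto (fun n => chainLength (x (φ n)) (N (φ n))) atTop (𝓝 L) :=
    (continuous_fst.tendsto _).comp hlim
  have hlimq : ∀ r : ℚ, Tendsto (fun n => stepCurve (x (φ n)) (N (φ n)) (r : ℝ)) atTop
      (𝓝 (q r)) := fun r =>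
    ((continuous_apply r).tendsto _).comp ((continuous_snd.tendsto _).comp hlim)
  have hsφ : Tendsto (fun n => s (φ n)) atTop (𝓝 0) := hslim.comp hφ.tendsto_atTop
  have hd : ∀ n a b, dist (stepCurve (x (φ n)) (N (φ n)) a) (stepCurve (x (φ n)) (N (φ n)) b)
      ≤ |b - a| + s (φ n) := fun n => dist_stepCurve_le _ (hs (φ n)) (hs0 (φ n))
  -- The almost 1-Lipschitz bound `hd` carries convergence from rational times to all real times.
  have hconv : ∀ t : ℝ, ∃ z, Tendsto (fun n => stepCurve (x (φ n)) (N (φ n)) t) atTop (𝓝 z) := by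
    intro t
    refine cauchySeq_tendsto_of_complete (Metric.cauchySeq_iff.2 fun ε hε => ?_)
    obtain ⟨r, hr1, hr2⟩ := exists_rat_btwn (show t < t + ε / 8 by linarith)
    have hrt : |(r : ℝ) - t| < ε / 8 := by rw [abs_of_pos] <;> linarith
    obtain ⟨n₀, hn₀⟩ := Metric.cauchySeq_iff.1 (hlimq r).cauchySeq (ε / 4) (by positivity)
    obtain ⟨n₁, hn₁⟩ := eventually_atTop.1 (hsφ.eventually (gt_mem_nhds
      (show (0 : ℝ) < ε / 8 by positivity)))
    refine ⟨max n₀ n₁, fun m hm n hn => ?_⟩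
    have h1 := hn₀ m ((le_max_left _ _).trans hm) n ((le_max_left _ _).trans hn)
    have h2 := hn₁ m ((le_max_right _ _).trans hm)
    have h3 := hn₁ n ((le_max_right _ _).trans hn)
    have h4 := hd m t r
    have h5 := hd n r t
    rw [abs_sub_comm] at h5
    have h6 := dist_triangle4 (stepCurve (x (φ m)) (N (φ m)) t) (stepCurve (x (φ m)) (N (φ m)) r)
      (stepCurve (x (φ n)) (N (φ n)) r) (stepCurve (x (φ n)) (N (φ n)) t)
    linarith
  choose c hc using hconv
  refine ⟨φ, hφ, L, c, hLq.1.1, LipschitzWith.of_dist_le_mul fun a b => ?_, hlimL, hc⟩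
  rw [NNReal.coe_one, one_mul, Real.dist_eq, abs_sub_comm]
  have := le_of_tendsto_of_tendsto' ((hc a).dist (hc b)) (hsφ.const_add |b - a|)
    fun n => hd n a b
  simpa using this

variable [MeasurableSpace X] [BorelSpace X]

/-- For fixed $m$, continuity of $g_m$ and $g_m\le g_{\varphi(n)}$ for large $n$ bound $g_m(c(t))$
by the lower limit of the integrands along the step curves. Take the supremum over $m$ and apply
Fatou. -/
theorem lintegral_limit_curve_le {h : X → ℝ≥0∞} {g : ℕ → X → ℝ} (hgc : ∀ n, Continuous (g n))
    (hgmono : ∀ z, Monotone fun n => g n z) (hg0 : ∀ n z, 0 ≤ g n z)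
    (hhg : ∀ z, h z ≤ ⨆ n, ENNReal.ofReal (g n z)) {x : ℕ → ℕ → X} {N : ℕ → ℕ} {φ : ℕ → ℕ}
    (hφ : StrictMono φ) {L : ℝ} {c : ℝ → X}
    (hL : Tendsto (fun n => chainLength (x (φ n)) (N (φ n))) atTop (𝓝 L))
    (hc : ∀ t, Tendsto (fun n => stepCurve (x (φ n)) (N (φ n)) t) atTop (𝓝 (c t))) :
    ∫⁻ t in Icc 0 L, h (c t)
      ≤ liminf (fun n => ENNReal.ofReal (chainCost (g (φ n)) (x (φ n)) (N (φ n)))) atTop := by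
  set F : ℕ → ℝ → ℝ≥0∞ := fun n => (Ico 0 (chainLength (x (φ n)) (N (φ n)))).indicator
    fun t => ENNReal.ofReal (g (φ n) (stepCurve (x (φ n)) (N (φ n)) t)) with hF
  have hFm : ∀ n, Measurable (F n) := fun n => Measurable.indicator
    (ENNReal.measurable_ofReal.comp ((hgc _).measurable.comp (measurable_stepCurve _ _)))
    measurableSet_Ico
  -- For $t<L$ the chains are eventually longer than $t$; at $t=L$ this may fail.
  rw [setLIntegral_congr Ico_ae_eq_Icc.symm]
  calc ∫⁻ t in Ico 0 L, h (c t) ≤ ∫⁻ t in Ico 0 L, liminf (fun n => F n t) atTop := by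
        refine setLIntegral_mono' measurableSet_Ico fun t ht => (hhg _).trans (iSup_le fun m => ?_)
        have hlim : Tendsto (fun n => ENNReal.ofReal (g m (stepCurve (x (φ n)) (N (φ n)) t)))
            atTop (𝓝 (ENNReal.ofReal (g m (c t)))) :=
          ENNReal.tendsto_ofReal (((hgc m).tendsto _).comp (hc t))
        rw [← hlim.liminf_eq]
        refine liminf_le_liminf ?_
        filter_upwards [hL.eventually (lt_mem_nhds ht.2), eventually_ge_atTop m] with n hn hmn
        rw [hF]
        dsimp only
        rw [indicator_of_mem (show t ∈ Ico 0 _ from ⟨ht.1, hn⟩)]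
        exact ENNReal.ofReal_le_ofReal (hgmono _ (hmn.trans (hφ.id_le n)))
    _ ≤ ∫⁻ t, liminf (fun n => F n t) atTop := setLIntegral_le_lintegral _ _
    _ ≤ liminf (fun n => ∫⁻ t, F n t) atTop := lintegral_liminf_le hFm
    _ ≤ _ := by
        refine liminf_le_liminf (Eventually.of_forall fun n => ?_)
        rw [hF]
        dsimp only
        rw [lintegral_indicator measurableSet_Ico]
        exact lintegral_stepCurve_le (hg0 _) _ _

/-- The chains have length at most $b/\eta$ and subconverge to a curve $c$ ending at $y$ with
$\int_c h\le b-v(c(0))$. The upper gradient inequality along $c$ then gives $v(y)\le b$. -/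
theorem le_of_forall_exists_chain [ProperSpace X] {v : X → ℝ} (hv : Continuous v)
    (hv0 : ∀ z, 0 ≤ v z) {h : X → ℝ≥0∞}
    (hvh : ∀ γ : RectifiableCurve X,
      ENNReal.ofReal |v (γ.toFun 0) - v (γ.toFun γ.length)| ≤ γ.integral h)
    {g : ℕ → X → ℝ} (hgc : ∀ n, Continuous (g n)) (hgmono : ∀ z, Monotone fun n => g n z)
    {η : ℝ} (hη : 0 < η) (hgη : ∀ n z, η ≤ g n z) (hhg : ∀ z, h z ≤ ⨆ n, ENNReal.ofReal (g n z))
    {y : X} {b : ℝ} (hchain : ∀ n : ℕ, ∃ (x : ℕ → X) (N : ℕ), x N = y ∧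
      (∀ i < N, dist (x i) (x (i + 1)) ≤ 1 / ((n : ℝ) + 1)) ∧ v (x 0) + chainCost (g n) x N < b) :
    v y ≤ b := by
  choose x N hN hstep hcost using hchain
  have hg0 : ∀ n z, 0 ≤ g n z := fun n z => hη.le.trans (hgη n z)
  have hR : ∀ n, chainLength (x n) (N n) ≤ b / η := fun n => by
    rw [le_div_iff₀ hη, mul_comm]
    linarith [mul_chainLength_le (hgη n) (x n) (N n), hcost n, hv0 (x n 0)]
  obtain ⟨φ, hφ, L, c, hL0, hc, hL, hlim⟩ := exists_limit_curve hstep (fun n => by positivity)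
    tendsto_one_div_add_atTop_nhds_zero_nat hN hR
  have hstart : Tendsto (fun n => x (φ n) 0) atTop (𝓝 (c 0)) := by
    simpa only [stepCurve_zero] using hlim 0
  -- The chain lengths only converge to `L`, so the end point is read off at times $t>L$, where the
  -- step curves have eventually stopped at `y`, and continuity brings it back to `L`.
  have hend : c L = y := by
    have hgt : ∀ t, L < t → c t = y := by
      intro t ht
      refine tendsto_nhds_unique (hlim t) (tendsto_const_nhds.congr' ?_)
      filter_upwards [hL.eventually (gt_mem_nhds ht)] with n hn
      rw [stepCurve_eq_of_chainLength_le _ hn.le, hN]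
    refine tendsto_nhds_unique
      ((hc.continuous.tendsto L).mono_left (nhdsWithin_le_nhds (s := Ioi L)))
      (tendsto_const_nhds.congr' ?_)
    filter_upwards [self_mem_nhdsWithin] with t ht using (hgt t ht).symm
  have hvlim : Tendsto (fun n => b - v (x (φ n) 0)) atTop (𝓝 (b - v (c 0))) :=
    ((hv.tendsto _).comp hstart).const_sub b
  have hb : 0 ≤ b - v (c 0) := ge_of_tendsto' hvlim fun n => by
    linarith [hcost (φ n), chainCost_nonneg (hg0 (φ n)) (x (φ n)) (N (φ n))]
  have hint : ∫⁻ t in Icc 0 L, h (c t) ≤ ENNReal.ofReal (b - v (c 0)) := by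
    refine (lintegral_limit_curve_le hgc hgmono hg0 hhg hφ hL hlim).trans ?_
    rw [← (ENNReal.tendsto_ofReal hvlim).liminf_eq]
    refine liminf_le_liminf (Eventually.of_forall fun n => ENNReal.ofReal_le_ofReal ?_)
    linarith [hcost (φ n)]
  have hfin := (ofReal_abs_sub_le_of_lipschitzWith hvh hc hL0).trans hint
  rw [ENNReal.ofReal_le_ofReal_iff hb, hend] at hfin
  linarith [neg_abs_le (v (c 0) - v y)]

end Limits

end NearDiagonal

/-! ### The Poincaré inequality for upper gradients -/

namespace NearDiagonal

variable {X : Type*} [MetricSpace X] [MeasurableSpace X] {μ : Measure X} {cD cP lam : ℝ}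

theorem RectifiableCurve.continuousOn {X : Type*} [MetricSpace X] (γ : RectifiableCurve X) :
    ContinuousOn γ.toFun (Icc 0 γ.length) := by
  refine (LipschitzOnWith.of_dist_le_mul (K := 1) fun a ha b hb => ?_).continuousOn
  rw [NNReal.coe_one, one_mul, Real.dist_eq]
  rcases le_total a b with hab | hab
  · rw [abs_sub_comm, abs_of_nonneg (sub_nonneg.2 hab)]
    exact γ.dist_le ha hb hab
  · rw [dist_comm, abs_of_nonneg (sub_nonneg.2 hab)]
    exact γ.dist_le hb ha hab

theorem RectifiableCurve.integral_mono {X : Type*} [MetricSpace X] (γ : RectifiableCurve X)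
    {f g : X → ℝ≥0∞} (hfg : ∀ x, f x ≤ g x) : γ.integral f ≤ γ.integral g :=
  lintegral_mono fun _ => hfg _

/-- A family of curves of modulus zero admits a function of small integral whose line integral is
infinite along each curve of the family. -/
theorem exists_integral_eq_top_of_modulusOne_eq_zero [BorelSpace X]
    {Γ : Set (RectifiableCurve X)} (hΓ : modulusOne μ Γ = 0) {ε : ℝ≥0∞} (hε : ε ≠ 0) :
    ∃ ρ : X → ℝ≥0∞, Measurable ρ ∧ (∀ γ ∈ Γ, γ.integral ρ = ∞) ∧ ∫⁻ x, ρ x ∂μ ≤ ε := by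
  obtain ⟨δ, hδ, hsum⟩ := ENNReal.exists_pos_sum_of_countable' hε ℕ
  have hex : ∀ n, ∃ ρ : X → ℝ≥0∞, Measurable ρ ∧ (∀ γ ∈ Γ, 1 ≤ γ.integral ρ) ∧
      ∫⁻ x, ρ x ∂μ < δ n := by
    intro n
    have h : modulusOne μ Γ < δ n := hΓ ▸ hδ n
    simp only [modulusOne, iInf_lt_iff] at h
    obtain ⟨ρ, h1, h2, h3⟩ := h
    exact ⟨ρ, h1, h2, h3⟩
  choose ρ hρm hρΓ hρδ using hex
  -- Each summand has line integral at least 1 along every curve of the family, so the sum has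
  -- infinite line integral.
  refine ⟨fun x => ∑' n, ρ n x, Measurable.tsum hρm, fun γ hγ => ?_, ?_⟩
  · have hm : AEMeasurable γ.toFun (volume.restrict (Icc 0 γ.length)) :=
      γ.continuousOn.aemeasurable measurableSet_Icc
    have hsum : γ.integral (fun x => ∑' n, ρ n x) = ∑' n, γ.integral (ρ n) :=
      lintegral_tsum fun n => (hρm n).comp_aemeasurable hm
    rw [hsum, ← top_le_iff, ← ENNReal.tsum_const_eq_top_of_ne_zero (α := ℕ) one_ne_zero]
    exact ENNReal.tsum_le_tsum fun n => hρΓ n γ hγ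
  · rw [lintegral_tsum fun n => (hρm n).aemeasurable]
    exact (ENNReal.tsum_le_tsum fun n => (hρδ n).le).trans hsum.le

/-- A weak upper gradient is dominated by a lower semicontinuous genuine upper gradient with
almost the same integral. -/
theorem IsWeakUpperGradient.exists_lowerSemicontinuous [BorelSpace X] [μ.WeaklyRegular]
    [SigmaFinite μ] {v : X → ℝ} {g : X → ℝ≥0∞} (hg : IsWeakUpperGradient μ v g) {ε : ℝ≥0∞}
    (hε : ε ≠ 0) :
    ∃ h : X → ℝ≥0∞, LowerSemicontinuous h ∧ (∀ γ : RectifiableCurve X,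
      ENNReal.ofReal |v (γ.toFun 0) - v (γ.toFun γ.length)| ≤ γ.integral h) ∧
      ∫⁻ x, h x ∂μ ≤ ∫⁻ x, g x ∂μ + ε := by
  have hε2 : ε / 2 ≠ 0 := (ENNReal.half_pos hε).ne'
  obtain ⟨ρ, hρm, hρΓ, hρε⟩ := exists_integral_eq_top_of_modulusOne_eq_zero hg.2 hε2
  -- Vitali–Carathéodory for $g+\rho$: on the exceptional curves the integral of $\rho$ is infinite,
  -- so the inequality is trivial there.
  obtain ⟨h, hle, hlsc, hint⟩ := exists_le_lowerSemicontinuous_lintegral_ge μ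
    (fun x => g x + ρ x) (hg.1.add hρm) hε2
  refine ⟨h, hlsc, fun γ => ?_, hint.trans ?_⟩
  · by_cases hγ : ENNReal.ofReal |v (γ.toFun 0) - v (γ.toFun γ.length)| ≤ γ.integral g
    · exact hγ.trans (γ.integral_mono fun x => le_self_add.trans (hle x))
    · have h1 : γ.integral ρ ≤ γ.integral h :=
        γ.integral_mono fun x => le_add_self.trans (hle x)
      rw [hρΓ γ hγ, top_le_iff] at h1
      rw [h1]
      exact le_top
  · rw [lintegral_add_left hg.1, add_assoc]
    gcongr
    calc ∫⁻ x, ρ x ∂μ + ε / 2 ≤ ε / 2 + ε / 2 := by gcongr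
      _ = ε := ENNReal.add_halves ε

section Poincare

theorem measurable_lintegral_abs_sub {X : Type*} [MeasurableSpace X] {ν : Measure X} [SFinite ν] {f : X → ℝ} (hf : Measurable f) :
    Measurable fun x => ∫⁻ y, ENNReal.ofReal |f x - f y| ∂ν :=
  (measurable_ofReal_abs_sub hf).lintegral_prod_right'

/-- Fatou twice. Oscillation is measured by a double integral because this form involves no mean
value and passes to pointwise limits. -/
theorem lintegral_lintegral_abs_sub_le_of_tendsto {X : Type*} [MeasurableSpace X]
    {ν : Measure X} [SFinite ν] {f : ℕ → X → ℝ}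
    {v : X → ℝ} (hf : ∀ n, Measurable (f n))
    (hlim : ∀ x, Tendsto (fun n => f n x) atTop (𝓝 (v x))) {b : ℝ≥0∞}
    (hb : ∀ n, ∫⁻ x, ∫⁻ y, ENNReal.ofReal |f n x - f n y| ∂ν ∂ν ≤ b) :
    ∫⁻ x, ∫⁻ y, ENNReal.ofReal |v x - v y| ∂ν ∂ν ≤ b := by
  calc ∫⁻ x, ∫⁻ y, ENNReal.ofReal |v x - v y| ∂ν ∂ν
      = ∫⁻ x, ∫⁻ y, liminf (fun n => ENNReal.ofReal |f n x - f n y|) atTop ∂ν ∂ν := by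
        refine lintegral_congr fun x => lintegral_congr fun y => ?_
        exact (ENNReal.tendsto_ofReal ((hlim x).sub (hlim y)).abs).liminf_eq.symm
    _ ≤ ∫⁻ x, liminf (fun n => ∫⁻ y, ENNReal.ofReal |f n x - f n y| ∂ν) atTop ∂ν :=
        lintegral_mono fun x => lintegral_liminf_le fun n =>
          (measurable_ofReal_abs_sub (hf n)).comp measurable_prodMk_left
    _ ≤ liminf (fun n => ∫⁻ x, ∫⁻ y, ENNReal.ofReal |f n x - f n y| ∂ν ∂ν) atTop :=
        lintegral_liminf_le fun n => measurable_lintegral_abs_sub (hf n)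
    _ ≤ b := liminf_le_of_le (by isBoundedDefault) fun a ha => by
        obtain ⟨n, hn⟩ := ha.exists
        exact hn.trans (hb n)

theorem lintegral_lintegral_abs_sub_le {X : Type*} [MeasurableSpace X] {ν : Measure X} {f : X → ℝ} (hf : Measurable f) (a : ℝ) :
    ∫⁻ x, ∫⁻ y, ENNReal.ofReal |f x - f y| ∂ν ∂ν
      ≤ 2 * ν univ * ∫⁻ x, ENNReal.ofReal |f x - a| ∂ν := by
  have hm : Measurable fun x => ENNReal.ofReal |f x - a| :=
    ENNReal.measurable_ofReal.comp (continuous_abs.measurable.comp (hf.sub_const a))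
  calc ∫⁻ x, ∫⁻ y, ENNReal.ofReal |f x - f y| ∂ν ∂ν
      ≤ ∫⁻ x, ∫⁻ y, (ENNReal.ofReal |f x - a| + ENNReal.ofReal |f y - a|) ∂ν ∂ν := by
        refine lintegral_mono fun x => lintegral_mono fun y => ?_
        rw [← ENNReal.ofReal_add (abs_nonneg _) (abs_nonneg _)]
        refine ENNReal.ofReal_le_ofReal ((abs_sub_le (f x) a (f y)).trans ?_)
        rw [abs_sub_comm a]
    _ = 2 * ν univ * ∫⁻ x, ENNReal.ofReal |f x - a| ∂ν := by
        simp_rw [lintegral_add_left measurable_const, lintegral_const]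
        rw [lintegral_add_right _ measurable_const, lintegral_mul_const _ hm, lintegral_const]
        ring

theorem SupportsPoincareWith.lintegral_lintegral_le [BorelSpace X]
    (hP : SupportsPoincareWith cP lam μ) {f : X → ℝ} (hf : ∃ K : ℝ≥0, LipschitzWith K f)
    (z : X) {r : ℝ} (hr : 0 < r) :
    ∫⁻ x in ball z r, ∫⁻ y in ball z r, ENNReal.ofReal |f x - f y| ∂μ ∂μ
      ≤ 2 * μ (ball z r) * (ENNReal.ofReal (cP * r) * ∫⁻ y in ball z (lam * r), lip f y ∂μ) := by
  have hfm : Measurable f := by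
    obtain ⟨K, hK⟩ := hf
    exact hK.continuous.measurable
  refine (lintegral_lintegral_abs_sub_le hfm (⨍ w in ball z r, f w ∂μ)).trans ?_
  rw [Measure.restrict_apply_univ]
  gcongr
  exact hP.poincare f hf z r hr

/-- The chain infima $f_n$ are Lipschitz, increase to $v$, and satisfy `lip` $f_n\le g_n\le h+\eta$;
the assumed inequality for $f_n$ survives the limit. -/
theorem poincare_bound_of_bounded [BorelSpace X] [ProperSpace X] [SFinite μ]
    (hD : IsDoublingWith cD μ) (hP : SupportsPoincareWith cP lam μ) {v : X → ℝ}
    (hv : Continuous v) (hv0 : ∀ x, 0 ≤ v x) {M : ℝ} (hvM : ∀ x, v x ≤ M) {h : X → ℝ≥0∞}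
    (hlsc : LowerSemicontinuous h) (hvh : ∀ γ : RectifiableCurve X,
      ENNReal.ofReal |v (γ.toFun 0) - v (γ.toFun γ.length)| ≤ γ.integral h)
    (z : X) {r : ℝ} (hr : 0 < r) :
    ∫⁻ x in ball z r, ∫⁻ y in ball z r, ENNReal.ofReal |v x - v y| ∂μ ∂μ
      ≤ 2 * μ (ball z r) * (ENNReal.ofReal (cP * r) * ∫⁻ y in ball z (lam * r), h y ∂μ) := by
  -- The summand $\eta$ keeps chains of bounded cost at bounded length; it is removed at the end
  -- because balls have finite measure.
  have hη : ∀ η : ℝ, 0 < η →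
      ∫⁻ x in ball z r, ∫⁻ y in ball z r, ENNReal.ofReal |v x - v y| ∂μ ∂μ
        ≤ 2 * μ (ball z r) * (ENNReal.ofReal (cP * r) *
          (∫⁻ y in ball z (lam * r), h y ∂μ + ENNReal.ofReal η * μ (ball z (lam * r)))) := by
    intro η hη
    set g : ℕ → X → ℝ := fun n x => (lipApprox h n x).toReal + η with hg
    have hgη : ∀ n x, η ≤ g n x := fun n x => le_add_of_nonneg_left ENNReal.toReal_nonneg
    have hg0 : ∀ n x, 0 ≤ g n x := fun n x => hη.le.trans (hgη n x)
    have hgc : ∀ n, Continuous (g n) := fun n =>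
      (continuous_toReal_lipApprox h n).add continuous_const
    have hgmono : ∀ x, Monotone fun n => g n x := fun x m n hmn =>
      add_le_add (ENNReal.toReal_mono (lipApprox_ne_top h n x) (lipApprox_mono h x hmn)) le_rfl
    have hgn : ∀ n x, g n x ≤ n + η := fun n x => add_le_add
      (ENNReal.toReal_le_of_le_ofReal (by positivity)
        (((lipApprox_le h n x).trans (min_le_right _ _)).trans_eq (by simp))) le_rfl
    have hgofReal : ∀ n x, ENNReal.ofReal (g n x) = lipApprox h n x + ENNReal.ofReal η :=
      fun n x => by
        rw [hg, ENNReal.ofReal_add ENNReal.toReal_nonneg hη.le,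
          ENNReal.ofReal_toReal (lipApprox_ne_top h n x)]
    have hhg : ∀ x, h x ≤ ⨆ n, ENNReal.ofReal (g n x) := fun x =>
      (le_iSup_lipApprox hlsc x).trans (iSup_mono fun n => by rw [hgofReal]; exact le_self_add)
    set s : ℕ → ℝ := fun n => 1 / ((n : ℝ) + 1) with hs
    have hs0 : ∀ n, 0 < s n := fun n => by positivity
    set f : ℕ → X → ℝ := fun n => chainInf v (g n) (s n) with hf
    have hflip : ∀ n, ∃ K : ℝ≥0, LipschitzWith K (f n) := fun n =>
      exists_lipschitzWith_chainInf hv0 hvM (hg0 n) (hgn n) (hs0 n)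
    have hfv : ∀ n x, f n x ≤ v x := fun n x => chainInf_le hv0 (hg0 n) x
    -- As `n` grows, fewer chains are admissible and each of them costs more.
    have hfmono : ∀ x, Monotone fun n => f n x := by
      intro x m n hmn
      refine le_csInf (nonempty_chainInf v (g n) (s n) x) ?_
      rintro _ ⟨p, N, hN, hstep, rfl⟩
      refine (csInf_le (bddBelow_chainInf hv0 (hg0 m) x) ⟨p, N, hN, fun i hi =>
        (hstep i hi).trans (one_div_le_one_div_of_le (by positivity) (by gcongr)), rfl⟩).trans ?_
      exact add_le_add le_rfl (Finset.sum_le_sum fun i _ =>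
        mul_le_mul_of_nonneg_right (hgmono _ hmn) dist_nonneg)
    have hflim : ∀ x, Tendsto (fun n => f n x) atTop (𝓝 (v x)) := by
      intro x
      refine tendsto_order.2 ⟨fun a ha => ?_, fun a ha =>
        Eventually.of_forall fun n => (hfv n x).trans_lt ha⟩
      obtain ⟨b, hab, hbv⟩ := exists_between ha
      obtain ⟨n, hn⟩ : ∃ n, b ≤ f n x := by
        by_contra! hcon
        exact absurd (le_of_forall_exists_chain hv hv0 hvh hgc hgmono hη hgη hhg
          fun n => exists_chain_of_chainInf_lt (hcon n)) (not_le.2 hbv)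
      filter_upwards [eventually_ge_atTop n] with m hm
      exact hab.trans_le (hn.trans (hfmono x hm))
    refine lintegral_lintegral_abs_sub_le_of_tendsto (f := f) (fun n => ?_) hflim fun n => ?_
    · obtain ⟨K, hK⟩ := hflip n
      exact hK.continuous.measurable
    · refine (hP.lintegral_lintegral_le (hflip n) z hr).trans ?_
      gcongr
      rw [← setLIntegral_const, ← lintegral_add_right _ measurable_const]
      refine lintegral_mono fun x => (lip_le_of_abs_sub_le (hgc n) (hs0 n)
        (fun y w hyw => abs_chainInf_sub_le hv0 (hg0 n) hyw) x).trans ?_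
      rw [hgofReal]
      gcongr
      exact (lipApprox_le h n x).trans (min_le_left _ _)
  have hlim : Tendsto (fun η : ℝ => 2 * μ (ball z r) * (ENNReal.ofReal (cP * r) *
      (∫⁻ y in ball z (lam * r), h y ∂μ + ENNReal.ofReal η * μ (ball z (lam * r))))) (𝓝[>] 0)
      (𝓝 (2 * μ (ball z r) * (ENNReal.ofReal (cP * r) *
        (∫⁻ y in ball z (lam * r), h y ∂μ + ENNReal.ofReal 0 * μ (ball z (lam * r)))))) := by
    have h1 : 2 * μ (ball z r) ≠ ∞ :=
      ENNReal.mul_ne_top ENNReal.ofNat_ne_top (hD.measure_ball_ne_top z r)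
    refine ENNReal.Tendsto.const_mul (ENNReal.Tendsto.const_mul (Tendsto.const_add _
      (ENNReal.Tendsto.mul_const ?_ (Or.inr (hD.measure_ball_ne_top z _))))
      (Or.inr ENNReal.ofReal_ne_top)) (Or.inr h1)
    exact (ENNReal.continuous_ofReal.tendsto 0).mono_left nhdsWithin_le_nhds
  rw [ENNReal.ofReal_zero, zero_mul, add_zero] at hlim
  exact ge_of_tendsto hlim (by filter_upwards [self_mem_nhdsWithin] with η h0 using hη η h0)

/-- The Poincaré inequality for continuous functions and lower semicontinuous upper gradients. -/
theorem poincare_bound [BorelSpace X] [ProperSpace X] [SFinite μ]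
    (hD : IsDoublingWith cD μ) (hP : SupportsPoincareWith cP lam μ) {v : X → ℝ}
    (hv : Continuous v) {h : X → ℝ≥0∞} (hlsc : LowerSemicontinuous h)
    (hvh : ∀ γ : RectifiableCurve X,
      ENNReal.ofReal |v (γ.toFun 0) - v (γ.toFun γ.length)| ≤ γ.integral h)
    (z : X) {r : ℝ} (hr : 0 < r) :
    ∫⁻ x in ball z r, ∫⁻ y in ball z r, ENNReal.ofReal |v x - v y| ∂μ ∂μ
      ≤ 2 * μ (ball z r) * (ENNReal.ofReal (cP * r) * ∫⁻ y in ball z (lam * r), h y ∂μ) := by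
  -- Truncation at $\pm n$ does not increase differences, so $h$ remains an upper gradient; adding
  -- $n$ makes the function nonnegative.
  set w : ℕ → X → ℝ := fun n x => max (-(n : ℝ)) (min n (v x)) with hw
  have hwc : ∀ n, Continuous (w n) := fun n => by fun_prop
  have hwsub : ∀ n x y, |w n x - w n y| ≤ |v x - v y| := fun n x y =>
    (abs_max_sub_max_le_max _ _ _ _).trans (max_le (by simp)
      ((abs_min_sub_min_le_max _ _ _ _).trans (max_le (by simp) le_rfl)))
  refine lintegral_lintegral_abs_sub_le_of_tendsto (f := w) (fun n => (hwc n).measurable)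
    (fun x => ?_) fun n => ?_
  · refine tendsto_const_nhds.congr' ?_
    obtain ⟨m, hm⟩ := exists_nat_ge |v x|
    filter_upwards [eventually_ge_atTop m] with n hn
    have hmn : (m : ℝ) ≤ n := by exact_mod_cast hn
    obtain ⟨h1, h2⟩ := abs_le.1 (hm.trans hmn)
    rw [hw]
    dsimp only
    rw [min_eq_right h2, max_eq_right h1]
  · have := poincare_bound_of_bounded hD hP (v := fun x => w n x + n) (M := n + n)
      ((hwc n).add continuous_const) (fun x => ?_) (fun x => ?_) hlsc (fun γ => ?_) z hr
    · simpa only [add_sub_add_right_eq_sub] using this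
    · linarith [le_max_left (-(n : ℝ)) (min n (v x))]
    · have h0 : -(n : ℝ) ≤ n := by linarith [Nat.cast_nonneg (α := ℝ) n]
      linarith [max_le h0 (min_le_left (n : ℝ) (v x))]
    · refine le_trans (ENNReal.ofReal_le_ofReal ?_) (hvh γ)
      simpa only [add_sub_add_right_eq_sub] using hwsub n _ _

end Poincare

/-! ### The energy is bounded by the total variation -/

theorem ballEnergy_le_gradientEnergy [BorelSpace X] [CompleteSpace X]
    (hD : IsDoublingWith cD μ) (hP : SupportsPoincareWith cP lam μ) {k : ℕ}
    (hk : 4 * lam ≤ 2 ^ k) {v : X → ℝ} (hv : Continuous v) {ε : ℝ} (hε : 0 < ε) :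
    ballEnergy μ v ε ≤ 2 * ENNReal.ofReal (cP * 2) * ENNReal.ofReal cD ^ (3 + k) *
      gradientEnergy μ v := by
  have := hD.properSpace
  have := hD.isLocallyFiniteMeasure
  set C := 2 * ENNReal.ofReal (cP * 2) * ENNReal.ofReal cD ^ (3 + k) with hCdef
  have hC : C ≠ ∞ := by finiteness
  have hC0 : C ≠ 0 :=
    mul_ne_zero (mul_ne_zero two_ne_zero (ENNReal.ofReal_pos.2 (by linarith [hP.const_pos])).ne')
      (pow_ne_zero _ (zero_lt_one.trans_le hD.one_le_ofReal).ne')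
  -- With the constant on the left, the claim is a lower bound for an infimum and can be checked for
  -- each weak upper gradient.
  rw [mul_comm, ← ENNReal.div_le_iff hC0 hC]
  refine le_iInf₂ fun g hg => ?_
  rw [ENNReal.div_le_iff hC0 hC, mul_comm]
  have hδ : ∀ δ : ℝ≥0∞, δ ≠ 0 → ballEnergy μ v ε ≤ C * (∫⁻ x, g x ∂μ + δ) := by
    intro δ hδ
    obtain ⟨h, hlsc, hvh, hint⟩ := hg.exists_lowerSemicontinuous hδ
    refine (hD.ballEnergy_le_of_poincare hv.measurable hlsc.measurable
      (fun z r hr => poincare_bound hD hP hv hlsc hvh z hr) hk hε).trans ?_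
    gcongr
  have hlim : Tendsto (fun δ : ℝ≥0∞ => C * (∫⁻ x, g x ∂μ + δ)) (𝓝[>] 0)
      (𝓝 (C * (∫⁻ x, g x ∂μ + 0))) :=
    ENNReal.Tendsto.const_mul (Tendsto.const_add _ nhdsWithin_le_nhds) (Or.inr hC)
  rw [add_zero] at hlim
  exact ge_of_tendsto hlim (by
    filter_upwards [self_mem_nhdsWithin] with δ h0 using hδ δ (ne_of_gt h0))

theorem totalVariation_congr_ae {u u' : X → ℝ} (h : u =ᵐ[μ] u') :
    totalVariation μ u = totalVariation μ u' := by
  have : ∀ v : ℕ → X → ℝ, TendstoL1Loc μ v u ↔ TendstoL1Loc μ v u' := by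
    intro v
    refine forall_congr' fun x => forall_congr' fun r => forall_congr' fun _ => ?_
    have : ∀ j, ∫⁻ y in ball x r, ENNReal.ofReal |v j y - u y| ∂μ
        = ∫⁻ y in ball x r, ENNReal.ofReal |v j y - u' y| ∂μ := fun j =>
      lintegral_congr_ae (ae_restrict_of_ae (h.mono fun y hy => by simp only [hy]))
    simp_rw [this]
  simp only [totalVariation, this]

theorem nearDiagonalEnergy_congr_ae [SFinite μ] {u u' : X → ℝ} (h : u =ᵐ[μ] u') (ε : ℝ) :
    nearDiagonalEnergy μ u ε = nearDiagonalEnergy μ u' ε := by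
  rw [nearDiagonalEnergy, nearDiagonalEnergy]
  congr 1
  refine lintegral_congr_ae (ae_restrict_of_ae ?_)
  filter_upwards [Measure.quasiMeasurePreserving_fst.ae h, Measure.quasiMeasurePreserving_snd.ae h]
    with p h1 h2
  rw [h1, h2]

/-- Semicontinuity at fixed $\varepsilon$ transfers the bound from locally Lipschitz approximants to
$u$. One more factor $c_D$ comes from changing the weight. -/
theorem nearDiagonalEnergy_le_totalVariation [BorelSpace X] [CompleteSpace X]
    (hD : IsDoublingWith cD μ) (hP : SupportsPoincareWith cP lam μ) {k : ℕ}
    (hk : 4 * lam ≤ 2 ^ k) {u : X → ℝ} (hu : Measurable u) {ε : ℝ} (hε : 0 < ε) :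
    nearDiagonalEnergy μ u ε ≤ ENNReal.ofReal (4 * cP * cD ^ (4 + k)) * totalVariation μ u := by
  have := hD.properSpace
  have := hD.isLocallyFiniteMeasure
  have h0 : 0 ≤ cD := zero_le_one.trans hD.one_le
  have hcP := hP.const_pos
  set C := 2 * ENNReal.ofReal (cP * 2) * ENNReal.ofReal cD ^ (3 + k) with hCdef
  have hC : C ≠ ∞ := by finiteness
  have hC0 : C ≠ 0 := by
    refine mul_ne_zero (mul_ne_zero two_ne_zero (ENNReal.ofReal_pos.2 (by positivity)).ne')
      (pow_ne_zero _ (zero_lt_one.trans_le hD.one_le_ofReal).ne')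
  have hmain : ballEnergy μ u ε / C ≤ totalVariation μ u := by
    refine le_iInf₂ fun v hv => le_iInf fun hvu => ?_
    rw [ENNReal.div_le_iff hC0 hC, mul_comm]
    calc ballEnergy μ u ε ≤ liminf (fun j => ballEnergy μ (v j) ε) atTop :=
          hD.ballEnergy_le_liminf hu (fun j => (hv j).continuous.measurable) hvu hε
      _ ≤ liminf (fun j => C * gradientEnergy μ (v j)) atTop :=
          liminf_le_liminf (Eventually.of_forall fun j =>
            ballEnergy_le_gradientEnergy hD hP hk (hv j).continuous hε)
      _ = C * liminf (fun j => gradientEnergy μ (v j)) atTop :=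
          ENNReal.liminf_const_mul_of_ne_top hC
  rw [ENNReal.div_le_iff hC0 hC] at hmain
  calc nearDiagonalEnergy μ u ε ≤ ENNReal.ofReal cD * ballEnergy μ u ε :=
        hD.nearDiagonalEnergy_le_ballEnergy hu ε
    _ ≤ ENNReal.ofReal cD * (totalVariation μ u * C) := by gcongr
    _ = _ := by
        rw [show 4 * cP * cD ^ (4 + k) = cD * (2 * (cP * 2) * cD ^ (3 + k)) by ring,
          ENNReal.ofReal_mul h0, ENNReal.ofReal_mul (by positivity),
          ENNReal.ofReal_mul (by positivity), ENNReal.ofReal_pow h0, ENNReal.ofReal_ofNat]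
        ring

end NearDiagonal

/-! ### The main theorem -/

theorem theorem3p1 (cD cP lam : ℝ) :
    ∃ C : ℝ, 0 < C ∧
      ∀ (X : Type*) [MetricSpace X] [CompleteSpace X] [MeasurableSpace X] [BorelSpace X]
        (μ : Measure X),
        NearDiagonal.IsDoublingWith cD μ →
        NearDiagonal.SupportsPoincareWith cP lam μ →
        ∀ u : X → ℝ, Integrable u μ →
          (NearDiagonal.IsBV μ u ↔
            liminf (fun ε : ℝ => NearDiagonal.nearDiagonalEnergy μ u ε) (𝓝[>] 0) < ∞) ∧
          (NearDiagonal.IsBV μ u → ∀ ε : ℝ, 0 < ε →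
            NearDiagonal.nearDiagonalEnergy μ u ε ≤
              ENNReal.ofReal C * NearDiagonal.totalVariation μ u) := by
  obtain ⟨k, hk⟩ := pow_unbounded_of_one_lt (4 * lam) (one_lt_two : (1 : ℝ) < 2)
  -- The constant is chosen before any hypothesis on `cP` and `cD` is available; the maximum with 1
  -- ensures that it is positive.
  refine ⟨max 1 (4 * cP * cD ^ (4 + k)), lt_max_of_lt_left one_pos, ?_⟩
  intro X _ _ _ _ μ hD hP u hu
  have := hD.properSpace
  have := hD.isLocallyFiniteMeasure
  -- The energy and the total variation ignore null sets, so a Borel representative may replace `u`.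
  set u' : X → ℝ := hu.1.mk u
  have hu'm : Measurable u' := hu.1.stronglyMeasurable_mk.measurable
  have hae : u =ᵐ[μ] u' := hu.1.ae_eq_mk
  have hbound : ∀ ε : ℝ, 0 < ε → NearDiagonal.nearDiagonalEnergy μ u ε ≤
      ENNReal.ofReal (max 1 (4 * cP * cD ^ (4 + k))) * NearDiagonal.totalVariation μ u := by
    intro ε hε
    rw [NearDiagonal.nearDiagonalEnergy_congr_ae hae, NearDiagonal.totalVariation_congr_ae hae]
    refine (NearDiagonal.nearDiagonalEnergy_le_totalVariation hD hP hk.le hu'm hε).trans ?_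
    gcongr
    exact le_max_right _ _
  refine ⟨⟨fun hBV => ?_, fun hE => ⟨hu, ?_⟩⟩, fun _ => hbound⟩
  · refine lt_of_le_of_lt (b := ENNReal.ofReal (max 1 (4 * cP * cD ^ (4 + k))) *
      NearDiagonal.totalVariation μ u) (liminf_le_of_le (by isBoundedDefault) fun b hb => ?_)
      (ENNReal.mul_lt_top ENNReal.ofReal_lt_top hBV.2)
    obtain ⟨ε, hbε, hε⟩ := (hb.and self_mem_nhdsWithin).exists
    exact hbε.trans (hbound ε hε)
  · simp_rw [NearDiagonal.nearDiagonalEnergy_congr_ae hae] at hE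
    rw [NearDiagonal.totalVariation_congr_ae hae]
    exact hD.totalVariation_lt_top hu'm (hu.congr hae) hE
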